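/- Let $m>0$, and consider the Newtonian planar three-body problem (gravitational constant $1$) with three equal masses $m_1=m_2=m_3=m$, that is, for positions $q_1,q_2,q_3\in\mathbb{C}\cong\mathbb{R}^2$, $$ m\,\ddot q_i=\sum_{j\ne i} m^2\,\frac{q_j-q_i}{|q_j-q_i|^3},\qquad i=1,2,3. $$ There are a period $T>0$, a $T$-periodic curve $s:\mathbb{R}\to\mathbb{C}$, and a solution $(q_1,q_2,q_3)$ of these equations that is defined and free of collisions for all times $t\in\mathbb{R}$, such that: (i) the angular momentum $\sum_{i=1}^3 m\,\operatorname{Im}(\overline{q_i}\,\dot q_i)$ vanishes identically; (ii) the solution is a choreography: all three bodies chase each other around the curve $s$ with equal time lags, $q_i(t)=s(t-iT/3)$ for $i=1,2,3$ and all $t$ (in particular, the solution is $T$-periodic); (iii) the curve $s$ is figure-eight shaped: it is a closed $C^1$ curve with nowhere vanishing derivative; within one period it has exactly one double point, i.e. there are $a<b<a+T$ such that $s(a)=s(b)$ and $s$ takes no other pair of distinct parameters in $[a,a+T)$ to the same point; it crosses itself transversally there, i.e. $\dot s(a)$ and $\dot s(b)$ are linearly independent over $\mathbb{R}$; and its two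 lobes $s([a,b])$ and $s([b,a+T])$ are not nested, i.e. apart from the double point each lobe lies in the unbounded component of the complement of the other. -/

import Mathlib

/-- The gravitational force (with gravitational constant `1`) exerted by body `i` on body `j`, for
three planar bodies with masses `m` at the positions `x`. -/
noncomputable def gravForce (m : Fin 3 → ℝ) (x : Fin 3 → ℂ) (i j : Fin 3) : ℂ :=
  (m i * m j / ‖x i - x j‖ ^ 3) • (x i - x j)

/-- `q i t` is the position of body `i` at time `t`: a collision-free solution, defined for all
times, of Newton's equations of the planar three-body problem with masses `m`. -/
structure IsThreeBodySolution (m : Fin 3 → ℝ) (q : Fin 3 → ℝ → ℂ) : Prop where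
  collision_free : ∀ t, ∀ i j, i ≠ j → q i t ≠ q j t
  differentiable : ∀ i, Differentiable ℝ (q i)
  differentiable_velocity : ∀ i, Differentiable ℝ (deriv (q i))
  newton : ∀ i t, m i • deriv (deriv (q i)) t =
    ∑ j ∈ Finset.univ.erase i, gravForce m (fun k => q k t) j i

/-- Total angular momentum of three planar bodies with masses `m`, positions `x`, velocities `v`:
the sum of the `m i * (x i ∧ v i)`, where `z ∧ w = Im (conj z * w)`. -/
noncomputable def angularMomentum (m : Fin 3 → ℝ) (x v : Fin 3 → ℂ) : ℝ :=
  ∑ i, m i * (starRingEnd ℂ (x i) * v i).im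

/-- The three bodies follow each other along the `T`-periodic curve `s`, with equal time lags.
The bodies numbered `1, 2, 3` are indexed by `0, 1, 2`, whence the `i + 1`. -/
structure IsChoreography (T : ℝ) (s : ℝ → ℂ) (q : Fin 3 → ℝ → ℂ) : Prop where
  period_pos : 0 < T
  periodic : Function.Periodic s T
  chase : ∀ (i : Fin 3) (t : ℝ), q i t = s (t - ((i : ℕ) + 1) * T / 3)

/-- A figure-eight shaped closed curve of period `T` in the plane: an immersed closed `C¹` curve
that has exactly one double point in a period, taken at the parameters `a < b < a + T`, crosses
itself transversally there, and whose two lobes (the loops over `[a, b]` and `[b, a + T]`) are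
not nested: apart from the double point, each lobe lies in the unbounded component of the
complement of the other one. -/
structure IsFigureEight (T : ℝ) (γ : ℝ → ℂ) : Prop where
  periodic : Function.Periodic γ T
  contDiff : ContDiff ℝ 1 γ
  immersed : ∀ t, deriv γ t ≠ 0
  crossing : ∃ a b : ℝ, a < b ∧ b < a + T ∧ γ a = γ b ∧
    (∀ s ∈ Set.Ico a (a + T), ∀ t ∈ Set.Ico a (a + T), s < t → γ s = γ t → s = a ∧ t = b) ∧
    LinearIndependent ℝ ![deriv γ a, deriv γ b] ∧
    (∀ z ∈ γ '' Set.Ioo a b,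
      ¬ Bornology.IsBounded (connectedComponentIn (γ '' Set.Icc b (a + T))ᶜ z)) ∧
    (∀ z ∈ γ '' Set.Ioo b (a + T),
      ¬ Bornology.IsBounded (connectedComponentIn (γ '' Set.Icc a b)ᶜ z))

open Set

/-! ### Radially truncated vector fields -/

/-! The proof is computer-assisted shooting over one twelfth of the period, after which symmetry
supplies everything else. For unit masses take period 12. The bodies `0, 1, 2` are called Z, Y, X.
At time 0 they are collinear, with X at the origin, Z = -Y, and Y and Z having equal velocities;
such data are given by four real numbers, and their angular momentum is zero. If the state at time 1
is an isosceles configuration symmetric about the real axis (four real equations,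
`isoscelesDefect`), then uniqueness of solutions gives two time-reversing symmetries, about time 0
and about time 1. Together they generate a shift by 2 that permutes the bodies. Applied twice, this
is a shift by 4 that permutes the bodies cyclically, hence a choreography. Fixing the end time and
the axis removes the freedom of scaling and rotation, so the zero is isolated.

To find the zero, the velocity and the attraction are truncated, which makes the vector field
bounded and globally Lipschitz: solutions are then global and unique, and Grönwall's inequality
applies unconditionally. A polynomial approximate orbit has a tiny residual
(`approxState_residual`). Four polynomial approximate solutions of the variational equation are
normalized so that their end defects are nearly the unit vectors. Hence `c - isoscelesDefect (x c
1)`, a Newton step with the identity in place of the inverse derivative, contracts a small ball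
(`exists_truncSolution_isosceles`). The true orbit stays so close to the polynomial that the
truncation is never active on `[0, 1]`, and therefore never at all.

Every numerical input is an inequality between integers. Sup bounds of polynomials on `[-1, 1]` come
from Chebyshev coefficients (`SupLe.abs_le`, `InfGe.le`).

The shape follows from signs on `[0, 1]`: X runs through the first quarter of the curve with
increasing real part in the upper half-plane, and the symmetries reflect this arc into two simple
lobes in opposite half-planes (`IsSymmetricEight.isFigureEight`). Scaling lengths by the cube root
of `m` treats all masses with the same period. -/

lemma norm_radial_sub_sq {E : Type*} [NormedAddCommGroup E] [InnerProductSpace ℝ E] (x y : E)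
    (p q : ℝ) :
    ‖p • x - q • y‖ ^ 2 = p * q * ‖x - y‖ ^ 2 - (q - p) * (p * ‖x‖ ^ 2 - q * ‖y‖ ^ 2) := by
  rw [norm_sub_sq_real, norm_sub_sq_real, norm_smul, norm_smul, real_inner_smul_left,
    real_inner_smul_right, mul_pow, mul_pow, Real.norm_eq_abs, Real.norm_eq_abs, sq_abs, sq_abs]
  ring

/-- Meant for radial maps `x ↦ p(‖x‖) • x`: the sign condition `h` holds when `p` decreases but `p r
^ 2` increases with the radius `r`, and the identity `norm_radial_sub_sq` then leaves `√(p q)` as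
the Lipschitz constant. -/
lemma norm_radial_sub_le {E : Type*} [NormedAddCommGroup E] [InnerProductSpace ℝ E] {x y : E}
    {p q c : ℝ} (hc : 0 ≤ c) (hpq : p * q ≤ c ^ 2)
    (h : 0 ≤ (q - p) * (p * ‖x‖ ^ 2 - q * ‖y‖ ^ 2)) :
    ‖p • x - q • y‖ ≤ c * ‖x - y‖ := by
  refine le_of_sq_le_sq ?_ (by positivity)
  rw [norm_radial_sub_sq, mul_pow]
  nlinarith [sq_nonneg ‖x - y‖]

/-- The velocity `z`, truncated to norm at most `1`. -/
noncomputable def truncVel (z : ℂ) : ℂ := (max ‖z‖ 1)⁻¹ • z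

/-- The attraction `z / ‖z‖ ^ 3`, made bounded near the collision. -/
noncomputable def truncForce (z : ℂ) : ℂ := (max ‖z‖ (49 / 50) ^ 3)⁻¹ • z

lemma truncVel_of_le {z : ℂ} (h : ‖z‖ ≤ 1) : truncVel z = z := by
  simp [truncVel, max_eq_right h]

lemma truncForce_of_le {z : ℂ} (h : 49 / 50 ≤ ‖z‖) : truncForce z = (‖z‖ ^ 3)⁻¹ • z := by
  simp [truncForce, max_eq_left h]

lemma norm_truncVel_le (z : ℂ) : ‖truncVel z‖ ≤ 1 := by
  have h1 : 0 < max ‖z‖ 1 := lt_max_of_lt_right one_pos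
  rw [truncVel, norm_smul, norm_inv, Real.norm_of_nonneg h1.le, inv_mul_le_iff₀ h1, mul_one]
  exact le_max_left _ _

lemma inv_max_monotone_aux {x y r : ℝ} (hx : 0 ≤ x) (hy : 0 ≤ y) (hr : 0 < r) :
    0 ≤ ((max y r)⁻¹ - (max x r)⁻¹) * ((max x r)⁻¹ * x ^ 2 - (max y r)⁻¹ * y ^ 2) := by
  wlog hxy : y ≤ x generalizing x y
  · have := this hy hx (le_of_not_ge hxy); linarith
  have ha : 0 < max x r := lt_max_of_lt_right hr
  have hb : 0 < max y r := lt_max_of_lt_right hr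
  have hab : max y r ≤ max x r := max_le_max_right r hxy
  refine mul_nonneg (sub_nonneg.2 (inv_anti₀ hb hab)) (sub_nonneg.2 ?_)
  rw [inv_mul_le_iff₀ hb, ← mul_assoc, mul_comm (max y r), mul_assoc, ← div_eq_inv_mul,
    le_div_iff₀ ha]
  rcases le_total x r with h | h
  · rw [max_eq_right h, max_eq_right (hxy.trans h), mul_comm]; gcongr
  · rw [max_eq_left h]
    have : y ^ 2 ≤ max y r * x := by
      rw [sq]; exact mul_le_mul (le_max_left _ _) hxy hy hb.le
    nlinarith

lemma truncVel_lipschitz (x y : ℂ) : ‖truncVel x - truncVel y‖ ≤ ‖x - y‖ := by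
  rw [← one_mul ‖x - y‖]
  refine norm_radial_sub_le zero_le_one ?_
    (inv_max_monotone_aux (norm_nonneg x) (norm_nonneg y) one_pos)
  rw [one_pow, ← mul_inv]
  exact inv_le_one_of_one_le₀ (one_le_mul_of_one_le_of_one_le (le_max_right _ _) (le_max_right _ _))

lemma inv_sq_max_monotone_aux {x y r : ℝ} (hx : 0 ≤ x) (hy : 0 ≤ y) (hr : 0 < r) :
    0 ≤ ((max y r ^ 2)⁻¹ - (max x r ^ 2)⁻¹) *
      ((max x r ^ 2)⁻¹ * x ^ 2 - (max y r ^ 2)⁻¹ * y ^ 2) := by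
  wlog hxy : y ≤ x generalizing x y
  · have := this hy hx (le_of_not_ge hxy); linarith
  have ha : 0 < max x r := lt_max_of_lt_right hr
  have hb : 0 < max y r := lt_max_of_lt_right hr
  have hab : max y r ≤ max x r := max_le_max_right r hxy
  refine mul_nonneg (sub_nonneg.2 (inv_anti₀ (by positivity) (by gcongr))) (sub_nonneg.2 ?_)
  rw [← div_eq_inv_mul, ← div_eq_inv_mul, ← div_pow, ← div_pow]
  refine pow_le_pow_left₀ (by positivity) ?_ 2
  rw [div_le_div_iff₀ hb ha]
  rcases le_total x r with h | h
  · rw [max_eq_right h, max_eq_right (hxy.trans h)]; gcongr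
  · rw [max_eq_left h, mul_comm]
    exact mul_le_mul_of_nonneg_left (le_max_left _ _) hx

/-- `norm_radial_sub_le` does not apply directly, as `r ^ 2 / r ^ 3` decreases. It does apply to the
truncated inversion `x / a ^ 2`; the remaining factor `1 / a` contributes an equal second term. The
constant 2 is the norm of the derivative of `z / ‖z‖ ^ 3` on the unit circle. -/
lemma truncForce_lipschitz (x y : ℂ) :
    ‖truncForce x - truncForce y‖ ≤ 2 * (50 / 49) ^ 3 * ‖x - y‖ := by
  set a := max ‖x‖ (49 / 50) with ha
  set b := max ‖y‖ (49 / 50) with hb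
  have ha0 : 49 / 50 ≤ a := le_max_right _ _
  have hb0 : 49 / 50 ≤ b := le_max_right _ _
  have hap : 0 < a := by linarith
  have hbp : 0 < b := by linarith
  have hia : a⁻¹ ≤ 50 / 49 := by
    rw [show (50 / 49 : ℝ) = (49 / 50)⁻¹ by norm_num]; exact inv_anti₀ (by norm_num) ha0
  have hib : b⁻¹ ≤ 50 / 49 := by
    rw [show (50 / 49 : ℝ) = (49 / 50)⁻¹ by norm_num]; exact inv_anti₀ (by norm_num) hb0
  have hia0 : 0 ≤ a⁻¹ := by positivity
  have hib0 : 0 ≤ b⁻¹ := by positivity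
  have hinv : ‖(a ^ 2)⁻¹ • x - (b ^ 2)⁻¹ • y‖ ≤ a⁻¹ * b⁻¹ * ‖x - y‖ := by
    refine norm_radial_sub_le (by positivity) (le_of_eq ?_)
      (inv_sq_max_monotone_aux (norm_nonneg x) (norm_nonneg y) (by norm_num))
    field_simp
  have hdec : truncForce x - truncForce y =
      a⁻¹ • ((a ^ 2)⁻¹ • x - (b ^ 2)⁻¹ • y) + (a⁻¹ - b⁻¹) • (b ^ 2)⁻¹ • y := by
    rw [sub_smul]
    simp only [truncForce, ← ha, ← hb, smul_sub, smul_smul, ← mul_inv, ← pow_succ']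
    abel
  have h2 : ‖(a⁻¹ - b⁻¹) • (b ^ 2)⁻¹ • y‖ ≤ a⁻¹ * b⁻¹ * b⁻¹ * ‖x - y‖ := by
    have e1 : |a⁻¹ - b⁻¹| ≤ a⁻¹ * b⁻¹ * ‖x - y‖ := by
      rw [inv_sub_inv hap.ne' hbp.ne', abs_div, abs_of_pos (mul_pos hap hbp), div_eq_inv_mul,
        mul_inv]
      refine mul_le_mul_of_nonneg_left ?_ (by positivity)
      rw [abs_sub_comm]
      exact (abs_max_sub_max_le_abs _ _ _).trans (abs_norm_sub_norm_le x y)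
    have e2 : ‖(b ^ 2)⁻¹ • y‖ ≤ b⁻¹ := by
      rw [norm_smul, Real.norm_of_nonneg (by positivity), inv_mul_le_iff₀ (by positivity), sq,
        mul_assoc, mul_inv_cancel₀ hbp.ne', mul_one]
      exact le_max_left _ _
    rw [norm_smul, Real.norm_eq_abs]
    calc _ ≤ (a⁻¹ * b⁻¹ * ‖x - y‖) * b⁻¹ := by gcongr
      _ = _ := by ring
  have h1 : ‖a⁻¹ • ((a ^ 2)⁻¹ • x - (b ^ 2)⁻¹ • y)‖ ≤ a⁻¹ * (a⁻¹ * b⁻¹) * ‖x - y‖ := by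
    rw [norm_smul, Real.norm_of_nonneg hia0, mul_assoc a⁻¹]
    gcongr
  rw [hdec]
  refine (norm_add_le _ _).trans ((add_le_add h1 h2).trans ?_)
  rw [← add_mul]
  refine mul_le_mul_of_nonneg_right ?_ (norm_nonneg _)
  have k1 : a⁻¹ * (a⁻¹ * b⁻¹) ≤ 50 / 49 * (50 / 49 * (50 / 49)) := by gcongr
  have k2 : a⁻¹ * b⁻¹ * b⁻¹ ≤ 50 / 49 * (50 / 49) * (50 / 49) := by gcongr
  linarith

lemma norm_truncForce_le (z : ℂ) : ‖truncForce z‖ ≤ 2 := by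
  set a := max ‖z‖ (49 / 50) with ha
  have ha0 : 49 / 50 ≤ a := le_max_right _ _
  have hap : 0 < a := by linarith
  rw [truncForce, norm_smul, ← ha, Real.norm_of_nonneg (by positivity),
    inv_mul_le_iff₀ (by positivity)]
  have h1 : ‖z‖ ≤ a := le_max_left _ _
  nlinarith [mul_pos hap hap, mul_le_mul ha0 ha0 (by norm_num) hap.le]

/-! ### Global solutions of bounded Lipschitz equations -/

section Global
variable {E : Type*} [NormedAddCommGroup E] [NormedSpace ℝ E]

/-- Since the field is bounded by `M`, the ball of radius `M * n` cannot be left within time `n`, so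
one application of Picard–Lindelöf covers the whole interval without continuation. -/
lemma exists_solution_Icc [CompleteSpace E] {f : E → E} {K M : NNReal} (hf : LipschitzWith K f)
    (hM : ∀ x, ‖f x‖ ≤ M) (x₀ : E) (n : ℕ) :
    ∃ x : ℝ → E, x 0 = x₀ ∧
      ∀ t ∈ Ioo (-(n : ℝ)) n, HasDerivAt x (f (x t)) t := by
  have h0 : (0 : ℝ) ∈ Icc (-(n : ℝ)) n := by simp
  have hpl : IsPicardLindelof (fun _ => f) (⟨0, h0⟩ : Icc (-(n : ℝ)) n) x₀ (M * n) 0 M K :=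
    { lipschitzOnWith := fun _ _ => hf.lipschitzOnWith
      continuousOn := fun _ _ => continuousOn_const
      norm_le := fun _ _ x _ => hM x
      mul_max_le := by simp }
  obtain ⟨x, hx0, hx⟩ := hpl.exists_eq_forall_mem_Icc_hasDerivWithinAt₀
  exact ⟨x, hx0, fun t ht => (hx t (Ioo_subset_Icc_self ht)).hasDerivAt (Icc_mem_nhds ht.1 ht.2)⟩

theorem exists_global_solution [CompleteSpace E] {f : E → E} {K M : NNReal}
    (hf : LipschitzWith K f) (hM : ∀ x, ‖f x‖ ≤ M) (x₀ : E) :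
    ∃ x : ℝ → E, x 0 = x₀ ∧ ∀ t, HasDerivAt x (f (x t)) t := by
  choose x hx0 hx using exists_solution_Icc hf hM x₀
  have key : ∀ (n k : ℕ) (t : ℝ), 0 < n → n ≤ k → t ∈ Ioo (-(n : ℝ)) n → x n t = x k t := by
    intro n k t hn hnk ht
    have hnk' : (n : ℝ) ≤ k := by exact_mod_cast hnk
    have hn' : (0 : ℝ) < n := by exact_mod_cast hn
    refine ODE_solution_unique_of_mem_Ioo (v := fun _ => f) (s := fun _ => univ) (K := K)
      (t₀ := 0) (fun _ _ => hf.lipschitzOnWith) ⟨by linarith, hn'⟩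
      (fun t ht => ⟨hx n t ht, mem_univ _⟩)
      (fun t ht => ⟨hx k t ⟨by linarith [ht.1], by linarith [ht.2]⟩, mem_univ _⟩)
      (by rw [hx0, hx0]) ht
  -- The local solutions agree on common intervals, so at time `t` the first one whose interval
  -- contains `t` is used. Near `t` all of these agree with the single solution of index `⌊|t|⌋₊ +
  -- 2`, which yields the derivative.
  refine ⟨fun t => x (⌊|t|⌋₊ + 1) t, hx0 _, fun t => ?_⟩
  have hfl (s : ℝ) : |s| < ((⌊|s|⌋₊ + 1 : ℕ) : ℝ) := by
    push_cast; exact Nat.lt_floor_add_one _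
  set N := ⌊|t|⌋₊ + 2 with hN
  have htN : t ∈ Ioo (-((N - 1 : ℕ) : ℝ)) ((N - 1 : ℕ) : ℝ) := abs_lt.1 (hfl t)
  have hle : ((N - 1 : ℕ) : ℝ) ≤ N := by exact_mod_cast Nat.sub_le _ _
  have heq : ∀ s ∈ Ioo (-((N - 1 : ℕ) : ℝ)) ((N - 1 : ℕ) : ℝ), x (⌊|s|⌋₊ + 1) s = x N s := by
    intro s hs
    refine key _ _ s (Nat.succ_pos _) ?_ (abs_lt.1 (hfl s))
    have : ⌊|s|⌋₊ < N - 1 := (Nat.floor_lt (abs_nonneg s)).2 (abs_lt.2 hs)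
    omega
  have hder := hx N t ⟨by linarith [htN.1], by linarith [htN.2]⟩
  rw [← heq t htN] at hder
  exact hder.congr_of_eventuallyEq
    (Filter.eventually_of_mem (Ioo_mem_nhds htN.1 htN.2) heq)

theorem global_solution_unique {f : E → E} {K : NNReal} (hf : LipschitzWith K f)
    {x y : ℝ → E} (hx : ∀ t, HasDerivAt x (f (x t)) t) (hy : ∀ t, HasDerivAt y (f (y t)) t)
    {t₀ : ℝ} (h : x t₀ = y t₀) : x = y :=
  ODE_solution_unique_univ (v := fun _ => f) (s := fun _ => univ) (K := K)
    (fun _ => hf.lipschitzOnWith) (fun t => ⟨hx t, mem_univ _⟩) (fun t => ⟨hy t, mem_univ _⟩) h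

end Global

/-! ### The truncated three-body vector field -/

/-- Positions of the three bodies, and a third of their velocities. -/
abbrev BodyState := (Fin 3 → ℂ) × (Fin 3 → ℂ)

/-- The truncated acceleration of the three bodies at the positions `q`. -/
noncomputable def truncAcc (q : Fin 3 → ℂ) (i : Fin 3) : ℂ := ∑ j, truncForce (q j - q i)

/-- The truncated three-body vector field, with velocities divided by `3`. -/
noncomputable def truncField (s : BodyState) : BodyState :=
  (fun i => (3 : ℝ) • truncVel (s.2 i), fun i => (3 : ℝ)⁻¹ • truncAcc s.1 i)

lemma truncForce_zero : truncForce 0 = 0 := by simp [truncForce]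

/-- A body exerts no force on itself, so two forces remain. Each changes by at most `2 * (50 / 49) ^
3` times `2 * ‖p - q‖`, which is below `9 / 2 * ‖p - q‖`. -/
lemma norm_truncAcc_sub_le (p q : Fin 3 → ℂ) (i : Fin 3) :
    ‖truncAcc p i - truncAcc q i‖ ≤ 9 * ‖p - q‖ := by
  have h (j k : Fin 3) : ‖truncForce (p j - p k) - truncForce (q j - q k)‖ ≤ 9 / 2 * ‖p - q‖ := by
    refine (truncForce_lipschitz _ _).trans ?_
    have h1 := norm_le_pi_norm (p - q) j
    have h2 := norm_le_pi_norm (p - q) k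
    have h3 : ‖p j - p k - (q j - q k)‖ ≤ 2 * ‖p - q‖ := by
      rw [show p j - p k - (q j - q k) = (p - q) j - (p - q) k by simp; ring]
      linarith [norm_sub_le ((p - q) j) ((p - q) k)]
    nlinarith [norm_nonneg (p - q), norm_nonneg (p j - p k - (q j - q k))]
  have key : ∃ j k, truncAcc p i - truncAcc q i =
      (truncForce (p j - p i) - truncForce (q j - q i)) +
        (truncForce (p k - p i) - truncForce (q k - q i)) := by
    fin_cases i
    · exact ⟨1, 2, by simp [truncAcc, Fin.sum_univ_three, truncForce_zero]; ring⟩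
    · exact ⟨0, 2, by simp [truncAcc, Fin.sum_univ_three, truncForce_zero]; ring⟩
    · exact ⟨0, 1, by simp [truncAcc, Fin.sum_univ_three, truncForce_zero]; ring⟩
  obtain ⟨j, k, e⟩ := key
  rw [e]
  linarith [norm_add_le (truncForce (p j - p i) - truncForce (q j - q i))
    (truncForce (p k - p i) - truncForce (q k - q i)), h j i, h k i]

/-- Dividing velocities by 3 balances the two components: the constants 1 and 9 become 3 and 3.
Grönwall's inequality over unit time thus costs only `exp 3`. -/
lemma truncField_lipschitz : LipschitzWith 3 truncField := by
  refine LipschitzWith.of_dist_le_mul fun s t => ?_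
  rw [dist_eq_norm, dist_eq_norm, NNReal.coe_ofNat, Prod.norm_def]
  have h1 : ‖s.1 - t.1‖ ≤ ‖s - t‖ := norm_fst_le (s - t)
  have h2 : ‖s.2 - t.2‖ ≤ ‖s - t‖ := norm_snd_le (s - t)
  refine max_le ?_ ?_
  · refine (pi_norm_le_iff_of_nonneg (by positivity)).2 fun i => ?_
    have h3 := norm_le_pi_norm (s.2 - t.2) i
    have h4 := truncVel_lipschitz (s.2 i) (t.2 i)
    simp only [truncField, Prod.fst_sub, Pi.sub_apply, ← smul_sub, norm_smul] at h3 ⊢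
    rw [Real.norm_of_nonneg (by norm_num)]
    linarith
  · refine (pi_norm_le_iff_of_nonneg (by positivity)).2 fun i => ?_
    have h4 := norm_truncAcc_sub_le s.1 t.1 i
    simp only [truncField, Prod.snd_sub, Pi.sub_apply, ← smul_sub, norm_smul]
    rw [Real.norm_of_nonneg (by norm_num)]
    linarith

lemma norm_truncField_le (s : BodyState) : ‖truncField s‖ ≤ (3 : NNReal) := by
  rw [Prod.norm_def, NNReal.coe_ofNat]
  refine max_le ?_ ?_
  · refine (pi_norm_le_iff_of_nonneg (by positivity)).2 fun i => ?_
    have h4 := norm_truncVel_le (s.2 i)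
    simp only [truncField, norm_smul]
    rw [Real.norm_of_nonneg (by norm_num)]
    linarith
  · refine (pi_norm_le_iff_of_nonneg (by positivity)).2 fun i => ?_
    simp only [truncField, norm_smul, truncAcc, Fin.sum_univ_three]
    rw [Real.norm_of_nonneg (by norm_num)]
    have h (j : Fin 3) := norm_truncForce_le (s.1 j - s.1 i)
    linarith [h 0, h 1, h 2, norm_add₃_le (a := truncForce (s.1 0 - s.1 i))
      (b := truncForce (s.1 1 - s.1 i)) (c := truncForce (s.1 2 - s.1 i))]

/-- `x` solves the truncated three-body equations for all times. -/
def IsTruncSolution (x : ℝ → BodyState) : Prop := ∀ t, HasDerivAt x (truncField (x t)) t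

lemma exists_truncSolution (x₀ : BodyState) : ∃ x, x 0 = x₀ ∧ IsTruncSolution x :=
  exists_global_solution truncField_lipschitz norm_truncField_le x₀

lemma IsTruncSolution.ext {x y : ℝ → BodyState} (hx : IsTruncSolution x) (hy : IsTruncSolution y)
    {t₀ : ℝ} (h : x t₀ = y t₀) : x = y :=
  global_solution_unique truncField_lipschitz hx hy h

lemma IsTruncSolution.hasDerivAt_fst {x : ℝ → BodyState} (hx : IsTruncSolution x) (i : Fin 3)
    (t : ℝ) : HasDerivAt (fun t => (x t).1 i) ((3 : ℝ) • truncVel ((x t).2 i)) t :=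
  hasDerivAt_pi.1 (hx t).fst i

lemma IsTruncSolution.hasDerivAt_snd {x : ℝ → BodyState} (hx : IsTruncSolution x) (i : Fin 3)
    (t : ℝ) : HasDerivAt (fun t => (x t).2 i) ((3 : ℝ)⁻¹ • truncAcc (x t).1 i) t :=
  hasDerivAt_pi.1 (hx t).snd i

lemma isTruncSolution_iff {x : ℝ → BodyState} : IsTruncSolution x ↔
    (∀ i t, HasDerivAt (fun t => (x t).1 i) ((3 : ℝ) • truncVel ((x t).2 i)) t) ∧
    ∀ i t, HasDerivAt (fun t => (x t).2 i) ((3 : ℝ)⁻¹ • truncAcc (x t).1 i) t :=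
  ⟨fun h => ⟨h.hasDerivAt_fst, h.hasDerivAt_snd⟩, fun h t =>
    (hasDerivAt_pi.2 fun i => h.1 i t).prodMk (hasDerivAt_pi.2 fun i => h.2 i t)⟩

/-- Time reversal about `c / 2`, combined with a relabelling `σ` of the bodies and an isometry `A`
of the plane. -/
noncomputable def reverseWith (A : ℂ ≃ₗᵢ[ℝ] ℂ) (σ : Equiv.Perm (Fin 3)) (c : ℝ) (x : ℝ → BodyState) (t : ℝ) :
    BodyState :=
  (fun i => A ((x (c - t)).1 (σ i)), fun i => -A ((x (c - t)).2 (σ i)))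

lemma truncForce_map (A : ℂ ≃ₗᵢ[ℝ] ℂ) (z : ℂ) : truncForce (A z) = A (truncForce z) := by
  simp only [truncForce, LinearIsometryEquiv.norm_map, map_smul]

lemma truncVel_map (A : ℂ ≃ₗᵢ[ℝ] ℂ) (z : ℂ) : truncVel (A z) = A (truncVel z) := by
  simp only [truncVel, LinearIsometryEquiv.norm_map, map_smul]

lemma truncVel_neg (z : ℂ) : truncVel (-z) = -truncVel z := by
  simp only [truncVel, norm_neg, smul_neg]

lemma truncForce_neg (z : ℂ) : truncForce (-z) = -truncForce z := by
  simp only [truncForce, norm_neg, smul_neg]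

lemma truncAcc_map (A : ℂ ≃ₗᵢ[ℝ] ℂ) (σ : Equiv.Perm (Fin 3)) (q : Fin 3 → ℂ) (i : Fin 3) :
    truncAcc (fun i => A (q (σ i))) i = A (truncAcc q (σ i)) := by
  simp only [truncAcc, map_sum, ← truncForce_map, map_sub]
  exact Equiv.sum_comp σ fun j => truncForce (A (q j) - A (q (σ i)))

/-- The truncations depend on norms only, so they commute with isometries, and `truncVel` is odd, so
reversing time and velocities preserves the equations. -/
lemma IsTruncSolution.reverseWith {x : ℝ → BodyState} (hx : IsTruncSolution x) (A : ℂ ≃ₗᵢ[ℝ] ℂ)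
    (σ : Equiv.Perm (Fin 3)) (c : ℝ) : IsTruncSolution (reverseWith A σ c x) := by
  have hA {f : ℝ → ℂ} {f' : ℂ} {t : ℝ} (h : HasDerivAt f f' (c - t)) :
      HasDerivAt (fun t => A (f (c - t))) (-A f') t := by
    have h2 : HasDerivAt (fun t => c - t) (-1) t := by simpa using (hasDerivAt_id t).const_sub c
    have h3 := h.scomp t h2
    have h4 := (A : ℂ ≃L[ℝ] ℂ).toContinuousLinearMap.hasFDerivAt.comp_hasDerivAt t h3
    exact h4.congr_deriv (by simp)
  refine isTruncSolution_iff.2 ⟨fun i t => ?_, fun i t => ?_⟩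
  · have := hA (hx.hasDerivAt_fst (σ i) (c - t))
    simpa only [_root_.reverseWith, truncVel_neg, truncVel_map, map_smul, smul_neg] using this
  · have := (hA (hx.hasDerivAt_snd (σ i) (c - t))).neg
    refine HasDerivAt.congr_deriv (f := fun t => -A ((x (c - t)).2 (σ i))) this ?_
    simp only [_root_.reverseWith, truncAcc_map, map_smul, neg_neg]

/-! ### Second-order bounds for the attraction -/

/-- The derivative of `z ↦ z / ‖z‖ ^ 3` at `z` in the direction `w`. -/
noncomputable def forceDeriv (z w : ℂ) : ℂ :=
  (‖z‖ ^ 5)⁻¹ • ((‖z‖ ^ 2) • w - (3 * (z.re * w.re + z.im * w.im)) • z)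

lemma hasDerivAt_truncForce_line {a d : ℂ} {t : ℝ} (h : 49 / 50 ≤ ‖a + t • d‖) :
    HasDerivAt (fun s : ℝ => (‖a + s • d‖ ^ 3)⁻¹ • (a + s • d)) (forceDeriv (a + t • d) d) t := by
  have hz : HasDerivAt (fun s : ℝ => a + s • d) d t := by
    simpa using ((hasDerivAt_id t).smul_const d).const_add a
  set z := a + t • d with hzd
  have hpos : 0 < ‖z‖ := by linarith
  have hn : HasDerivAt (fun s : ℝ => ‖a + s • d‖) ((z.re * d.re + z.im * d.im) / ‖z‖) t := by
    have h1 := hz.norm_sq.sqrt (by positivity)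
    simp only [Real.sqrt_sq (norm_nonneg _)] at h1
    refine h1.congr_deriv ?_
    rw [← hzd, Complex.inner]
    simp [Complex.mul_re]
    ring
  have hp := ((hn.pow 3).inv (by simp only [Pi.pow_apply]; positivity)).smul hz
  refine hp.congr_deriv ?_
  simp only [Pi.pow_apply, ← hzd, Pi.inv_apply]
  rw [forceDeriv, smul_sub, smul_smul, smul_smul]
  have e1 : (‖z‖ ^ 5)⁻¹ * ‖z‖ ^ 2 = (‖z‖ ^ 3)⁻¹ := by field_simp
  rw [e1, sub_eq_add_neg, ← neg_smul]
  congr 2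
  field_simp
  norm_num
  ring

/-- This is the splitting into a complex-linear and an antilinear part. The coefficients are
products of simple radial functions of `z`, whose variation is easy to bound. -/
lemma forceDeriv_eq {z : ℂ} (hz : z ≠ 0) (w : ℂ) : forceDeriv z w =
    -(1 / 2 : ℝ) • ((‖z‖ ^ 3)⁻¹ • w) -
      (3 / 2 : ℝ) • (((‖z‖ ^ 3)⁻¹ • z) * ((‖z‖ ^ 2)⁻¹ • z) * (starRingEnd ℂ) w) := by
  have hp : 0 < ‖z‖ := norm_pos_iff.2 hz
  have h2 : ‖z‖ ^ 2 = z.re ^ 2 + z.im ^ 2 := by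
    rw [← Complex.normSq_eq_norm_sq, Complex.normSq_apply]; ring
  have e1 : (‖z‖ ^ 3)⁻¹ = (‖z‖ ^ 5)⁻¹ * ‖z‖ ^ 2 := by field_simp
  have e2 : (‖z‖ ^ 3)⁻¹ * (‖z‖ ^ 2)⁻¹ = (‖z‖ ^ 5)⁻¹ := by field_simp
  have e3 : ((‖z‖ ^ 3)⁻¹ • z) * ((‖z‖ ^ 2)⁻¹ • z) = (‖z‖ ^ 5)⁻¹ • z ^ 2 := by
    rw [smul_mul_smul_comm, e2, sq]
  rw [e3, e1, forceDeriv, h2]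
  apply Complex.ext <;> simp [sq, Complex.mul_re, Complex.mul_im] <;> ring

lemma norm_inv_sq_smul_sub_le {x y : ℂ} (hx : 49 / 50 ≤ ‖x‖) (hy : 49 / 50 ≤ ‖y‖) :
    ‖(‖x‖ ^ 2)⁻¹ • x - (‖y‖ ^ 2)⁻¹ • y‖ ≤ (50 / 49) ^ 2 * ‖x - y‖ := by
  have hx0 : 0 < ‖x‖ := by linarith
  have hy0 : 0 < ‖y‖ := by linarith
  refine norm_radial_sub_le (by positivity) ?_ ?_
  · rw [← mul_inv, ← pow_mul, show ((50 : ℝ) / 49) ^ (2 * 2) = ((49 / 50) ^ 2 * (49 / 50) ^ 2)⁻¹ by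
      norm_num]
    gcongr
  · rw [inv_mul_cancel₀ (by positivity), inv_mul_cancel₀ (by positivity)]
    simp

/-- Both coefficients in `forceDeriv_eq` vary at rate at most `3 * (50 / 49) ^ 4`, so the total is
`6 * (50 / 49) ^ 4 < 7`. -/
lemma norm_forceDeriv_sub_le {x y : ℂ} (hx : 49 / 50 ≤ ‖x‖) (hy : 49 / 50 ≤ ‖y‖) (w : ℂ) :
    ‖forceDeriv x w - forceDeriv y w‖ ≤ 7 * ‖x - y‖ * ‖w‖ := by
  have hx0 : 0 < ‖x‖ := by linarith
  have hy0 : 0 < ‖y‖ := by linarith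
  have hxi : ‖x‖⁻¹ ≤ 50 / 49 := by
    rw [show (50 / 49 : ℝ) = (49 / 50)⁻¹ by norm_num]; exact inv_anti₀ (by norm_num) hx
  have hyi : ‖y‖⁻¹ ≤ 50 / 49 := by
    rw [show (50 / 49 : ℝ) = (49 / 50)⁻¹ by norm_num]; exact inv_anti₀ (by norm_num) hy
  have hxi0 : 0 < ‖x‖⁻¹ := by positivity
  have hyi0 : 0 < ‖y‖⁻¹ := by positivity
  set D := ‖x - y‖ with hD
  have hD0 : 0 ≤ D := norm_nonneg _
  have hxy : |‖x‖⁻¹ - ‖y‖⁻¹| ≤ (50 / 49) ^ 2 * D := by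
    rw [inv_sub_inv hx0.ne' hy0.ne', abs_div, abs_of_pos (mul_pos hx0 hy0), div_eq_inv_mul, mul_inv]
    have : |‖y‖ - ‖x‖| ≤ D := by rw [abs_sub_comm]; exact abs_norm_sub_norm_le x y
    rw [sq]
    gcongr
  have hcub : |(‖x‖ ^ 3)⁻¹ - (‖y‖ ^ 3)⁻¹| ≤ 3 * (50 / 49) ^ 4 * D := by
    have e : (‖x‖ ^ 3)⁻¹ - (‖y‖ ^ 3)⁻¹ = (‖x‖⁻¹ - ‖y‖⁻¹) *
        (‖x‖⁻¹ * ‖x‖⁻¹ + ‖x‖⁻¹ * ‖y‖⁻¹ + ‖y‖⁻¹ * ‖y‖⁻¹) := by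
      rw [← inv_pow, ← inv_pow]; ring
    rw [e, abs_mul, abs_of_pos (by positivity : 0 < ‖x‖⁻¹ * ‖x‖⁻¹ + ‖x‖⁻¹ * ‖y‖⁻¹ + ‖y‖⁻¹ * ‖y‖⁻¹)]
    calc _ ≤ ((50 / 49) ^ 2 * D) * (50 / 49 * (50 / 49) + 50 / 49 * (50 / 49)
          + 50 / 49 * (50 / 49)) := by gcongr
      _ = _ := by ring
  have hprod : ‖((‖x‖ ^ 3)⁻¹ • x) * ((‖x‖ ^ 2)⁻¹ • x) - ((‖y‖ ^ 3)⁻¹ • y) * ((‖y‖ ^ 2)⁻¹ • y)‖ ≤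
      3 * (50 / 49) ^ 4 * D := by
    rw [← truncForce_of_le hx, ← truncForce_of_le hy]
    have e : truncForce x * ((‖x‖ ^ 2)⁻¹ • x) - truncForce y * ((‖y‖ ^ 2)⁻¹ • y) =
      (truncForce x - truncForce y) * ((‖x‖ ^ 2)⁻¹ • x) +
        truncForce y * ((‖x‖ ^ 2)⁻¹ • x - (‖y‖ ^ 2)⁻¹ • y) := by ring
    have b1 : ‖(‖x‖ ^ 2)⁻¹ • x‖ ≤ 50 / 49 := by
      rw [norm_smul, Real.norm_of_nonneg (by positivity), sq, mul_inv, mul_assoc,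
        inv_mul_cancel₀ hx0.ne', mul_one]
      exact hxi
    have b2 : ‖truncForce y‖ ≤ (50 / 49) ^ 2 := by
      rw [truncForce_of_le hy, norm_smul, Real.norm_of_nonneg (by positivity), pow_succ, mul_inv,
        mul_assoc, inv_mul_cancel₀ hy0.ne', mul_one, ← inv_pow]
      gcongr
    rw [e]
    calc _ ≤ _ := norm_add_le _ _
      _ ≤ (2 * (50 / 49) ^ 3 * D) * (50 / 49) + (50 / 49) ^ 2 * ((50 / 49) ^ 2 * D) := by
        rw [norm_mul, norm_mul]
        gcongr
        · exact truncForce_lipschitz x y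
        · exact norm_inv_sq_smul_sub_le hx hy
      _ = _ := by ring
  rw [forceDeriv_eq (norm_pos_iff.1 hx0), forceDeriv_eq (norm_pos_iff.1 hy0)]
  have e : -(1 / 2 : ℝ) • ((‖x‖ ^ 3)⁻¹ • w) -
      (3 / 2 : ℝ) • (((‖x‖ ^ 3)⁻¹ • x) * ((‖x‖ ^ 2)⁻¹ • x) * (starRingEnd ℂ) w) -
      (-(1 / 2 : ℝ) • ((‖y‖ ^ 3)⁻¹ • w) -
      (3 / 2 : ℝ) • (((‖y‖ ^ 3)⁻¹ • y) * ((‖y‖ ^ 2)⁻¹ • y) * (starRingEnd ℂ) w)) =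
      -(1 / 2 : ℝ) • (((‖x‖ ^ 3)⁻¹ - (‖y‖ ^ 3)⁻¹) • w) - (3 / 2 : ℝ) •
        ((((‖x‖ ^ 3)⁻¹ • x) * ((‖x‖ ^ 2)⁻¹ • x) - ((‖y‖ ^ 3)⁻¹ • y) * ((‖y‖ ^ 2)⁻¹ • y)) *
          (starRingEnd ℂ) w) := by
    rw [sub_smul, sub_mul, smul_sub, smul_sub]; abel
  rw [e]
  refine (norm_sub_le _ _).trans ?_
  rw [norm_smul, norm_smul, norm_smul, norm_mul, RCLike.norm_conj, Real.norm_eq_abs, Real.norm_eq_abs,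
    Real.norm_eq_abs, abs_neg, abs_of_pos (by norm_num : (0 : ℝ) < 1 / 2),
    abs_of_pos (by norm_num : (0 : ℝ) < 3 / 2)]
  calc _ ≤ 1 / 2 * (3 * (50 / 49) ^ 4 * D * ‖w‖) + 3 / 2 * (3 * (50 / 49) ^ 4 * D * ‖w‖) := by
        gcongr
    _ = 6 * (50 / 49) ^ 4 * D * ‖w‖ := by ring
    _ ≤ 7 * D * ‖w‖ := by gcongr; norm_num

/-- Mean value inequality along the segment from `a` to `a + d`, with the derivative frozen at the
nearby point `a₀` of the approximate orbit. The bound is linear in `‖d‖` with a small factor, as a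
contraction estimate needs. -/
lemma norm_truncForce_sub_forceDeriv_le {a₀ a d : ℂ} {η : ℝ} (h₀ : 49 / 50 + η ≤ ‖a₀‖)
    (ha : ‖a - a₀‖ ≤ η) (hd : ‖a + d - a₀‖ ≤ η) :
    ‖truncForce (a + d) - truncForce a - forceDeriv a₀ d‖ ≤ 7 * η * ‖d‖ := by
  have hη : 0 ≤ η := (norm_nonneg _).trans ha
  have hseg (t : ℝ) (ht : t ∈ Icc (0 : ℝ) 1) : ‖a + t • d - a₀‖ ≤ η := by
    have e : a + t • d - a₀ = (1 - t) • (a - a₀) + t • (a + d - a₀) := by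
      simp only [smul_sub, smul_add, sub_smul, one_smul]; abel
    rw [e]
    refine (norm_add_le _ _).trans ?_
    rw [norm_smul, norm_smul, Real.norm_of_nonneg ht.1, Real.norm_of_nonneg (by linarith [ht.2])]
    nlinarith [ht.1, ht.2]
  have hlow (t : ℝ) (ht : t ∈ Icc (0 : ℝ) 1) : 49 / 50 ≤ ‖a + t • d‖ := by
    have := norm_sub_norm_le a₀ (a₀ - (a + t • d))
    rw [sub_sub_cancel, norm_sub_rev a₀] at this
    linarith [hseg t ht]
  have hder (t : ℝ) (ht : t ∈ Icc (0 : ℝ) 1) : HasDerivWithinAt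
      (fun s : ℝ => (‖a + s • d‖ ^ 3)⁻¹ • (a + s • d) - s • forceDeriv a₀ d)
      (forceDeriv (a + t • d) d - forceDeriv a₀ d) (Icc 0 1) t := by
    have h2 : HasDerivAt (fun s : ℝ => s • forceDeriv a₀ d) (forceDeriv a₀ d) t := by
      simpa using (hasDerivAt_id t).smul_const (forceDeriv a₀ d)
    exact ((hasDerivAt_truncForce_line (hlow t ht)).sub h2).hasDerivWithinAt
  have := norm_image_sub_le_of_norm_deriv_le_segment_01' hder (C := 7 * η * ‖d‖) (fun t ht => by
    have ht' := Ico_subset_Icc_self ht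
    refine (norm_forceDeriv_sub_le (hlow t ht') (by linarith) d).trans ?_
    gcongr
    exact hseg t ht')
  simp only [one_smul, zero_smul, add_zero, sub_zero] at this
  have h1 := hlow 1 (by simp)
  have h0 := hlow 0 (by simp)
  rw [one_smul] at h1
  rw [zero_smul, add_zero] at h0
  rw [truncForce_of_le h1, truncForce_of_le h0]
  rwa [sub_right_comm]

/-! ### Sup-norm bounds for integer polynomials -/

namespace IntPoly

/-- Sum of polynomials given by their coefficient lists. -/
def add : List ℤ → List ℤ → List ℤ
  | [], m => m
  | a :: l, [] => a :: l
  | a :: l, b :: m => (a + b) :: add l m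

/-- Multiple of a polynomial. -/
def smul (c : ℤ) : List ℤ → List ℤ
  | [] => []
  | a :: l => (c * a) :: smul c l

/-- Product of polynomials. -/
def mul : List ℤ → List ℤ → List ℤ
  | [], _ => []
  | a :: l, m => add (smul a m) (0 :: mul l m)

/-- The polynomial `p (-t)`. -/
def refl : List ℤ → List ℤ
  | [] => []
  | a :: l => a :: smul (-1) (refl l)

/-- The derivative of a polynomial. -/
def der : List ℤ → List ℤ
  | [] => []
  | _ :: l => add l (0 :: der l)

/-- Value of a polynomial. -/
noncomputable def eval : List ℤ → ℝ → ℝ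
  | [], _ => 0
  | a :: l, t => a + t * eval l t

/-- Sum of the absolute values of the coefficients. -/
def norm1 : List ℤ → ℤ
  | [] => 0
  | a :: l => |a| + norm1 l

/-- Multiplication by `2 * t` in the Chebyshev basis. -/
def twiceT : List ℤ → List ℤ
  | [] => []
  | a :: l => add (0 :: a :: l) (add [0, a] l)

/-- The coefficients of `2 ^ l.length * l` in the Chebyshev basis. -/
def toCheb : List ℤ → List ℤ
  | [] => []
  | a :: l => add [((2 ^ (l.length + 1) : ℕ) : ℤ) * a] (twiceT (toCheb l))

/-- Certifies `|l| ≤ B` on `[-1, 1]`. -/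
def SupLe (l : List ℤ) (B : ℤ) : Prop := norm1 (toCheb l) ≤ B * ((2 ^ l.length : ℕ) : ℤ)

/-- Constant coefficient minus the absolute values of the others. -/
def headDominance : List ℤ → ℤ
  | [] => 0
  | a :: l => a - norm1 l

/-- Certifies `B ≤ l` on `[-1, 1]`. -/
def InfGe (l : List ℤ) (B : ℤ) : Prop := B * ((2 ^ l.length : ℕ) : ℤ) ≤ headDominance (toCheb l)

instance (l : List ℤ) (B : ℤ) : Decidable (SupLe l B) := Int.decLe _ _

instance (l : List ℤ) (B : ℤ) : Decidable (InfGe l B) := Int.decLe _ _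

@[simp] lemma eval_nil (t : ℝ) : eval [] t = 0 := rfl

@[simp] lemma eval_cons (a : ℤ) (l : List ℤ) (t : ℝ) : eval (a :: l) t = a + t * eval l t := rfl

@[simp] lemma eval_add (l m : List ℤ) (t : ℝ) : eval (add l m) t = eval l t + eval m t := by
  induction l generalizing m with
  | nil => simp [add]
  | cons a l ih =>
    cases m with
    | nil => simp [add]
    | cons b m => simp [add, ih]; ring

@[simp] lemma eval_smul (c : ℤ) (l : List ℤ) (t : ℝ) : eval (smul c l) t = c * eval l t := by
  induction l with
  | nil => simp [smul]
  | cons a l ih => simp [smul, ih]; ring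

@[simp] lemma eval_mul (l m : List ℤ) (t : ℝ) : eval (mul l m) t = eval l t * eval m t := by
  induction l with
  | nil => simp [mul]
  | cons a l ih => simp [mul, ih]; ring

@[simp] lemma eval_refl (l : List ℤ) (t : ℝ) : eval (refl l) t = eval l (-t) := by
  induction l with
  | nil => simp [refl]
  | cons a l ih => simp [refl, ih]

lemma hasDerivAt_eval (l : List ℤ) (t : ℝ) : HasDerivAt (eval l) (eval (der l) t) t := by
  induction l with
  | nil => exact hasDerivAt_const t 0
  | cons a l ih =>
    refine (((hasDerivAt_id t).mul ih).const_add (a : ℝ)).congr_deriv ?_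
    simp [der]

/-- Value of a cosine polynomial with frequencies shifted by `j`. -/
noncomputable def chebEval (θ : ℝ) : List ℤ → ℝ → ℝ
  | [], _ => 0
  | a :: l, j => a * Real.cos (j * θ) + chebEval θ l (j + 1)

lemma chebEval_add (θ : ℝ) (l m : List ℤ) (j : ℝ) :
    chebEval θ (add l m) j = chebEval θ l j + chebEval θ m j := by
  induction l generalizing m j with
  | nil => simp [add, chebEval]
  | cons a l ih =>
    cases m with
    | nil => simp [add, chebEval]
    | cons b m => simp [add, chebEval, ih]; ring

lemma chebEval_shift (θ : ℝ) (l : List ℤ) (j : ℝ) :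
    chebEval θ l (j + 1) + chebEval θ l (j - 1) = 2 * Real.cos θ * chebEval θ l j := by
  induction l generalizing j with
  | nil => simp [chebEval]
  | cons a l ih =>
    have := ih (j + 1)
    rw [show j + 1 - 1 = j - 1 + 1 by ring] at this
    simp only [chebEval, mul_add, ← this, add_mul, sub_mul, one_mul, Real.cos_add, Real.cos_sub]
    ring

/-- Multiplication by `2 cos θ` shifts frequencies up and down. The constant term shifted down has
frequency -1, which equals frequency 1; this is the extra `[0, a]` in `twiceT`. -/
lemma chebEval_twiceT (θ : ℝ) (l : List ℤ) :
    chebEval θ (twiceT l) 0 = 2 * Real.cos θ * chebEval θ l 0 := by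
  cases l with
  | nil => simp [twiceT, chebEval]
  | cons a l =>
    rw [← chebEval_shift, twiceT, chebEval_add, chebEval_add]
    simp [chebEval]

lemma chebEval_toCheb (θ : ℝ) (l : List ℤ) :
    chebEval θ (toCheb l) 0 = 2 ^ l.length * eval l (Real.cos θ) := by
  induction l with
  | nil => simp [toCheb, chebEval]
  | cons a l ih =>
    rw [toCheb, chebEval_add, chebEval_twiceT, ih]
    simp [chebEval]
    ring

lemma abs_chebEval_le (θ : ℝ) (l : List ℤ) (j : ℝ) : |chebEval θ l j| ≤ norm1 l := by
  induction l generalizing j with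
  | nil => simp [chebEval, norm1]
  | cons a l ih =>
    simp only [chebEval, norm1]
    push_cast
    refine (abs_add_le _ _).trans (add_le_add ?_ (ih _))
    rw [abs_mul]
    exact mul_le_of_le_one_right (abs_nonneg _) (Real.abs_cos_le_one _)

/-- With `t = cos θ` the Chebyshev basis consists of cosines, each at most 1 in absolute value. The
factor `2 ^ l.length` keeps the coefficients integral. -/
theorem SupLe.abs_le {l : List ℤ} {B : ℤ} (h : SupLe l B) {t : ℝ} (ht : t ∈ Icc (-1 : ℝ) 1) :
    |eval l t| ≤ B := by
  have h1 := abs_chebEval_le (Real.arccos t) (toCheb l) 0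
  rw [chebEval_toCheb, Real.cos_arccos ht.1 ht.2, abs_mul, abs_of_pos (by positivity)] at h1
  have h2 : ((norm1 (toCheb l) : ℤ) : ℝ) ≤ B * 2 ^ l.length := by
    rw [SupLe] at h; exact_mod_cast h
  have h3 : (0 : ℝ) < 2 ^ l.length := by positivity
  nlinarith

theorem InfGe.le {l : List ℤ} {B : ℤ} (h : InfGe l B) {t : ℝ} (ht : t ∈ Icc (-1 : ℝ) 1) :
    B ≤ eval l t := by
  have h1 : ((headDominance (toCheb l) : ℤ) : ℝ) ≤ chebEval (Real.arccos t) (toCheb l) 0 := by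
    cases toCheb l with
    | nil => simp [headDominance, chebEval]
    | cons a m =>
      have := neg_le_of_abs_le (abs_chebEval_le (Real.arccos t) m (0 + 1))
      simp only [headDominance, chebEval, zero_mul, Real.cos_zero, mul_one]
      push_cast
      linarith
  rw [chebEval_toCheb, Real.cos_arccos ht.1 ht.2] at h1
  have h2 : (B : ℝ) * 2 ^ l.length ≤ ((headDominance (toCheb l) : ℤ) : ℝ) := by
    rw [InfGe] at h; exact_mod_cast h
  have h3 : (0 : ℝ) < 2 ^ l.length := by positivity
  nlinarith

end IntPoly

/-! ### A polynomial approximation of the figure-eight solution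

All polynomials are approximations on `[-1, 1]`; the body `Y` of the orbit and the functions derived
from it are given in units of `10 ^ (-16)`, the variational solutions in units of `10 ^ (-9)`. -/

namespace FigureEightData
open IntPoly

/-- Real part of the position of the body `Y`. -/
def yRe : List ℤ :=
  [14864341030513858, -3766081505023588, -2581723634291414, -610514421826812, 25514986837824,
    214100155445984, 138539872683488, 47873590322176, -7320283128320, -23323043711488,
    -18194293178368, -7589627999232, 312928905216, 3444453842944, 3125584723968, 1400634621952,
    -35070902272, -420325359616, -359562739712, -498354880512, -349347250176, 238260584448,
    401189371904, 26675773440, -152848826368, -38587596800, 25199378432, 7247757312, -1207959552]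

/-- Imaginary part of the position of the body `Y`. -/
def yIm : List ℤ :=
  [-3725071896917501, -3492732105662923, 646991759403868, 769447112935660, 501212977989072,
    154498063902080, -27658242019232, -68786859832832, -49004588579200, -18216501444608,
    1864898243584, 8825184261120, 7412917514240, 3331053772800, 10129440768, -1488834707456,
    -1338504904704, -469225701376, -47665381376, -87018438656, 205713833984, 504311578624,
    123069267968, -302493204480, -155247968256, 79003910144, 55431921664, -8187281408,
    -7247757312]

/-- Inverse distance between the bodies `X` and `Y`. -/
def invA : List ℤ :=
  [6525713818784519, 3582342116448352, 784020230128382, -494608605530312, -569284401554920,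
    -447010092464992, -173644868424832, 40201992417408, 111634669603072, 98807583524608,
    42987639756288, -4945280980992, -23006704517120, -19542728785920, -11966682398720,
    -7020871090176, 4913156489216, 13678916141056, 4545966768128, -5644454199296, -3271544012800,
    818235310080, 625377017856]

/-- Inverse distance between the bodies `Y` and `Z`. -/
def invD : List ℤ :=
  [3262856909384028, 0, 566711621026500, 0, 119102343956736, 0, -5768231483968, 0,
    -8176058793472, 0, 499644009472, 0, 1155478808576, 0, 24318222336, 0, -292606672896, 0,
    63354699776, 0, 20545798144, 0, -7472152576]

/-- Real part of the first variational solution. -/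
def linRe0 : List ℤ :=
  [-260689130, -42499956, 40298226, 111660612, 87028008, 22692256, -27132480, -39354304,
    -23959808, -3453952, 8929792, 9166848, 3926016, 3059712, 1351680, -5373952, -4980736,
    2031616, 2752512, -262144, -524288, 0, 0, 0, 0]

/-- Imaginary part of the first variational solution. -/
def linIm0 : List ℤ :=
  [-999709500, 130869808, 174883098, 37740624, -44508400, -71705936, -47038464, -7904960,
    16916096, 19767040, 11103232, 2955264, -2439168, -6864896, -5611520, 999424, 3506176, 851968,
    -655360, -262144, 0, 0, 0, 0, 0]

/-- Real part of the second variational solution. -/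
def linRe1 : List ℤ :=
  [-537308166, -170894655, -141571998, -32872360, 64992584, 94328112, 47285504, -4503424,
    -28444416, -25660928, -12054016, -644096, 6846464, 9715712, 4530176, -3014656, -3833856,
    -458752, 786432, 262144, 0, 0, 0, 0, 0]

/-- Imaginary part of the second variational solution. -/
def linIm1 : List ℤ :=
  [-232208174, -192800941, 99196960, 125047540, 85687992, -2139840, -54858976, -52206144,
    -23421824, 3456512, 15206400, 11862016, 5033984, 2752512, -1679360, -7634944, -3833856,
    3407872, 2621440, -524288, -524288, 0, 0, 0, 0]

/-- Real part of the third variational solution. -/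
def linRe2 : List ℤ :=
  [-1136818581, 378261959, -333277340, 49385436, 137922776, 88204560, -17272768, -61029760,
    -44852864, -10275328, 11425280, 14240768, 10160128, 7016448, -1744896, -10174464, -4816896,
    3866624, 2883584, -524288, -524288, 0, 0, 0, 0]

/-- Imaginary part of the third variational solution. -/
def linIm2 : List ℤ :=
  [-216649364, -150837836, 170631412, 160391332, 26868056, -86547424, -89922624, -29439360,
    20338048, 32304640, 20604416, 6152192, -3979264, -10874880, -9216000, 835584, 5668864,
    1835008, -1048576, -524288, 0, 0, 0, 0, 0]

/-- Real part of the fourth variational solution. -/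
def linRe3 : List ℤ :=
  [-112176049, -25233848, -12391032, 30804736, 62491680, 50026512, 8054656, -22636288,
    -26690688, -15157760, -2782720, 4287488, 8394752, 7409664, -262144, -4849664, -1867776,
    917504, 524288, 0, 0, 0, 0, 0, 0]

/-- Imaginary part of the fourth variational solution. -/
def linIm3 : List ℤ :=
  [-188192271, -173140823, 40674012, 41326300, 5278472, -37781872, -49783232, -29602304,
    -2640384, 12448256, 12918272, 7761920, 4255744, -1630208, -7929856, -4374528, 3047424,
    2752512, -393216, -524288, 0, 0, 0, 0, 0]

/-- Inverse fifth power of the norm of `Y - X`. -/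
def invFifthA : List ℤ :=
  [118342334, 324824786, 427719928, 307028480, 49276520, -175432928, -257534016, -194470592,
    -58218752, 60427264, 102358528, 81616896, 52281344, 9519104, -62349312, -78315520, -2719744,
    45613056, 17170432, -8650752, -4718592]

/-- Entry `11` of the derivative of the attraction at `Y - X`. -/
def tideA11 : List ℤ :=
  [-506530145, -502954383, 608646816, 1857692640, 1803170504, 401917472, -1175802560,
    -1830240320, -1307134976, -170447360, 645484032, 775434240, 793821184, 655044608, -378052608,
    -1189314560, -374865920, 583598080, 330694656, -101711872, -74448896]

/-- Entry `12` of the derivative of the attraction at `Y - X`. -/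
def tideA12 : List ℤ :=
  [196581091, 943112798, 1329538086, 411411748, -1225845864, -2131979952, -1628741632,
    -223559104, 1024006400, 1309038336, 848561664, 479145984, -86958080, -1236496384,
    -1201946624, 466911232, 1027637248, 41943040, -342884352, -40894464, 41418752]

/-- Entry `22` of the derivative of the attraction at `Y - X`. -/
def tideA22 : List ℤ :=
  [228633008, 45292881, -960045920, -1950446140, -1703289072, -237344208, 1303211232,
    1877249664, 1285703424, 120407040, -686456832, -794301440, -796125184, -641761280, 401186816,
    1199603712, 365559808, -593035264, -330825728, 103809024, 74973184]

/-- Inverse fifth power of the norm of `Y - Z`. -/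
def invFifthD : List ℤ :=
  [3698197, 0, 3211632, 0, 1790632, 0, 629248, 0, 122240, 0, -5120, 0, 2048, 0, 0, 0, 0, 0, 0,
    0, 0]

/-- Entry `11` of the derivative of the attraction at `Y - Z`. -/
def tideD11 : List ℤ :=
  [-63316270, 0, -32991354, 0, -14243536, 0, -3518560, 0, -165888, 0, 215552, 0, -16384, 0, 0]

/-- Entry `12` of the derivative of the attraction at `Y - Z`. -/
def tideD12 : List ℤ :=
  [24572633, 0, 12803772, 0, 1961928, 0, -1160512, 0, -791424, 0, -175104, 0, 63488, 0, -8192]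

/-- Entry `22` of the derivative of the attraction at `Y - Z`. -/
def tideD22 : List ℤ :=
  [28579126, 0, 14891408, 0, 7294528, 0, 2207200, 0, 214144, 0, -107008, 0, -36864, 0, 8192]

/-- Real parts of the variational solutions. -/
def linRe : Fin 4 → List ℤ := ![linRe0, linRe1, linRe2, linRe3]

/-- Imaginary parts of the variational solutions. -/
def linIm : Fin 4 → List ℤ := ![linIm0, linIm1, linIm2, linIm3]

/-- Difference of polynomials. -/
def sub (l m : List ℤ) : List ℤ := add l (smul (-1) m)

@[simp] lemma eval_sub (l m : List ℤ) (t : ℝ) : eval (sub l m) t = eval l t - eval m t := by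
  simp [sub]; ring

/-- A coordinate of `Y - X`, from that of `Y`. -/
def pairA (l : List ℤ) : List ℤ := sub (smul 2 l) (refl l)

/-- A coordinate of `Y - Z`, from that of `Y`. -/
def pairD (l : List ℤ) : List ℤ := add l (refl l)

@[simp] lemma eval_pairA (l : List ℤ) (t : ℝ) :
    eval (pairA l) t = 2 * eval l t - eval l (-t) := by
  simp [pairA]

@[simp] lemma eval_pairD (l : List ℤ) (t : ℝ) : eval (pairD l) t = eval l t + eval l (-t) := by
  simp [pairD]

/-- Squared norm of the vector with coordinates `l`, `m`. -/
def normSq (l m : List ℤ) : List ℤ := add (mul l l) (mul m m)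

/-- Cube of a polynomial. -/
def cube (l : List ℤ) : List ℤ := mul l (mul l l)

/-- An inverse distance `v` is certified through `v ^ 2 * a ^ 2 ≈ 1`, which is polynomial; here `10
^ 64` stands for 1 and the tolerance is `10 ^ (-10)`. Positivity of `v` is checked separately to fix
the sign of the root. -/
lemma invA_sup : SupLe (sub (mul (mul invA invA) (normSq (pairA yRe) (pairA yIm))) [10 ^ 64])
    (10 ^ 54) := by decide +kernel

lemma invD_sup : SupLe (sub (mul (mul invD invD) (normSq (pairD yRe) (pairD yIm))) [10 ^ 64])
    (10 ^ 54) := by decide +kernel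

lemma invA_pos : InfGe invA (10 ^ 15) := by decide +kernel

lemma invD_pos : InfGe invD (10 ^ 15) := by decide +kernel

lemma invA_le : SupLe invA (10 ^ 14 * 101) := by decide +kernel

lemma invD_le : SupLe invD (10 ^ 14 * 101) := by decide +kernel

/-- A coordinate of the residual of `Y` in Newton's equations. -/
def residual (l : List ℤ) : List ℤ :=
  add (smul (10 ^ 48) (der (der l))) (add (mul (cube invA) (pairA l)) (mul (cube invD) (pairD l)))

lemma residual_re : SupLe (residual yRe) (10 ^ 54) := by decide +kernel

lemma residual_im : SupLe (residual yIm) (10 ^ 54) := by decide +kernel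

/-- Fifth power of a polynomial. -/
def fifth (l : List ℤ) : List ℤ := mul (mul l l) (cube l)

/-- The variational equations need much less precision, so the fifth powers are replaced by shorter
polynomials in units of `10 ^ (-9)`, with error at most `10 ^ (-7)`. -/
lemma invFifthA_sup : SupLe (sub (fifth invA) (smul (10 ^ 71) invFifthA)) (10 ^ 73) := by
  decide +kernel

lemma invFifthD_sup : SupLe (sub (fifth invD) (smul (10 ^ 71) invFifthD)) (10 ^ 73) := by
  decide +kernel

/-- The error of the approximation `m` of a diagonal entry of the derivative of the attraction. -/
def diagError (k p q m : List ℤ) : List ℤ :=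
  sub (mul k (sub (mul q q) (smul 2 (mul p p)))) (smul (10 ^ 32) m)

/-- The error of the approximation `m` of the other entry of the derivative of the attraction. -/
def offDiagError (k p q m : List ℤ) : List ℤ :=
  sub (mul k (smul (-3) (mul p q))) (smul (10 ^ 32) m)

lemma tideA11_sup : SupLe (diagError invFifthA (pairA yRe) (pairA yIm) tideA11) (10 ^ 35) := by
  decide +kernel

lemma tideA12_sup : SupLe (offDiagError invFifthA (pairA yRe) (pairA yIm) tideA12) (10 ^ 35) := by
  decide +kernel

lemma tideA22_sup : SupLe (diagError invFifthA (pairA yIm) (pairA yRe) tideA22) (10 ^ 35) := by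
  decide +kernel

lemma tideD11_sup : SupLe (diagError invFifthD (pairD yRe) (pairD yIm) tideD11) (10 ^ 35) := by
  decide +kernel

lemma tideD12_sup : SupLe (offDiagError invFifthD (pairD yRe) (pairD yIm) tideD12) (10 ^ 35) := by
  decide +kernel

lemma tideD22_sup : SupLe (diagError invFifthD (pairD yIm) (pairD yRe) tideD22) (10 ^ 35) := by
  decide +kernel

lemma sqA_re_le : SupLe (mul (pairA yRe) (pairA yRe)) (20 * 10 ^ 32) := by decide +kernel

lemma sqA_im_le : SupLe (mul (pairA yIm) (pairA yIm)) (20 * 10 ^ 32) := by decide +kernel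

lemma sqD_re_le : SupLe (mul (pairD yRe) (pairD yRe)) (20 * 10 ^ 32) := by decide +kernel

lemma sqD_im_le : SupLe (mul (pairD yIm) (pairD yIm)) (20 * 10 ^ 32) := by decide +kernel

/-- A coordinate of the residual of a variational solution. -/
def linResidual (a b c d l m : List ℤ) : List ℤ :=
  add (smul (10 ^ 9) (der (der l))) (add (add (mul a (pairA l)) (mul b (pairA m)))
    (add (mul c (pairD l)) (mul d (pairD m))))

lemma linResidual_re : ∀ k, SupLe
    (linResidual tideA11 tideA12 tideD11 tideD12 (linRe k) (linIm k)) (10 ^ 14) := by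
  decide +kernel

lemma linResidual_im : ∀ k, SupLe
    (linResidual tideA22 tideA12 tideD22 tideD12 (linIm k) (linRe k)) (10 ^ 14) := by
  decide +kernel

lemma linRe_le : ∀ k, SupLe (linRe k) (10 ^ 8 * ![4, 8, 19, 2] k) := by decide +kernel

lemma linIm_le : ∀ k, SupLe (linIm k) (10 ^ 8 * ![12, 4, 4, 4] k) := by decide +kernel

lemma der_linRe_le : ∀ k, SupLe (der (linRe k)) (10 ^ 8 * ![5, 4, 12, 3] k) := by decide +kernel

lemma der_linIm_le : ∀ k, SupLe (der (linIm k)) (10 ^ 8 * ![5, 5, 5, 5] k) := by decide +kernel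

/-- Value of a polynomial at an integer. -/
def evalInt : List ℤ → ℤ → ℤ
  | [], _ => 0
  | a :: l, n => a + n * evalInt l n

lemma eval_intCast (l : List ℤ) (n : ℤ) : eval l n = evalInt l n := by
  induction l with
  | nil => simp [evalInt]
  | cons a l ih => simp [evalInt, ih]

/-- The conditions for a symmetric isosceles configuration at time `1`, for the body `Y` with the
coordinates `l`, `m`. -/
def endCondition (l m : List ℤ) : Fin 4 → ℤ :=
  ![-evalInt m (-1), evalInt l (-1) - 2 * evalInt l 1, evalInt (der l) (-1),
    -evalInt (der m) (-1) - 2 * evalInt (der m) 1]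

lemma endCondition_le : ∀ i, |endCondition yRe yIm i| ≤ 10 ^ 6 := by decide +kernel

/-- The normalization of the variational solutions: the `k`-th one has the `k`-th unit vector as end
defect, up to `10 ^ (-3)`. The shooting map therefore has derivative close to the identity. -/
lemma endCondition_lin_le : ∀ k i, |endCondition (linRe k) (linIm k) i -
    if i = k then 10 ^ 9 else 0| ≤ 10 ^ 6 := by decide +kernel

lemma velX_re_le : SupLe (pairD (der yRe)) (10 ^ 15 * 15) := by decide +kernel

lemma velX_im_le : SupLe (pairD (der yIm)) (10 ^ 15 * 14) := by decide +kernel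

lemma velY_re_le : SupLe (der yRe) (10 ^ 16) := by decide +kernel

lemma velY_im_le : SupLe (der yIm) (10 ^ 16) := by decide +kernel

lemma velX_re_neg : InfGe (smul (-1) (pairD (der yRe))) (10 ^ 14) := by decide +kernel

lemma velX_im_neg : InfGe (smul (-1) (pairD (der yIm))) (10 ^ 14) := by decide +kernel

/-- This velocity nearly vanishes at `t = -1`, so it has no useful sign bound on all of `[-1, 1]`.
Subtracting an affine function gives a bound that is effective on `[0, 1]`; the next lemma does the
same for the position. -/
lemma velY_re_neg : InfGe (sub (smul (-1) (der yRe)) [3 * 10 ^ 15, 3 * 10 ^ 15])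
    (-(2 * 10 ^ 15)) := by decide +kernel

lemma posY_im_neg : InfGe (sub (smul (-1) yIm) [25 * 10 ^ 14, 25 * 10 ^ 14]) (-(10 ^ 15)) := by
  decide +kernel

lemma accY_re_neg : InfGe (smul (-1) (der (der yRe))) (10 ^ 14) := by decide +kernel

/-- Effective for `t ≤ 0` only, which suffices: the velocity of Z at time `t` is that of Y at time
`-t`. -/
lemma velY_im_neg : InfGe (add (smul (-1) (der yIm)) [0, 26 * 10 ^ 14]) (10 ^ 14) := by
  decide +kernel

end FigureEightData

/-! ### From integer certificates to real bounds for the approximate orbit -/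

namespace FigureEightData
open IntPoly

/-- The plane curve with the polynomial coordinates `l / c`, `m / c`. -/
noncomputable def curve (c : ℝ) (l m : List ℤ) (t : ℝ) : ℂ := ⟨eval l t / c, eval m t / c⟩

@[simp] lemma curve_re (c : ℝ) (l m : List ℤ) (t : ℝ) : (curve c l m t).re = eval l t / c := rfl

@[simp] lemma curve_im (c : ℝ) (l m : List ℤ) (t : ℝ) : (curve c l m t).im = eval m t / c := rfl

lemma hasDerivAt_curve (c : ℝ) (l m : List ℤ) (t : ℝ) :
    HasDerivAt (curve c l m) (curve c (der l) (der m) t) t := by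
  have h := ((hasDerivAt_eval l t).div_const c).ofReal_comp.add
    (((hasDerivAt_eval m t).div_const c).ofReal_comp.mul_const Complex.I)
  have e (l m : List ℤ) (t : ℝ) : curve c l m t =
      ((eval l t / c : ℝ) : ℂ) + ((eval m t / c : ℝ) : ℂ) * Complex.I := by
    apply Complex.ext <;> simp
  rw [e]
  exact h.congr_of_eventuallyEq (Filter.Eventually.of_forall fun s => e l m s)

lemma curve_pairA (c : ℝ) (l m : List ℤ) (t : ℝ) :
    curve c (pairA l) (pairA m) t = 2 * curve c l m t - curve c l m (-t) := by
  apply Complex.ext <;> simp <;> ring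

lemma curve_pairD (c : ℝ) (l m : List ℤ) (t : ℝ) :
    curve c (pairD l) (pairD m) t = curve c l m t + curve c l m (-t) := by
  apply Complex.ext <;> simp <;> ring

lemma norm_curve_le {c a b t : ℝ} (hc : 0 < c) {l m : List ℤ} (hl : |eval l t| ≤ a * c)
    (hm : |eval m t| ≤ b * c) : ‖curve c l m t‖ ≤ a + b := by
  refine (Complex.norm_le_abs_re_add_abs_im _).trans (add_le_add ?_ ?_)
  · rw [curve_re, abs_div, abs_of_pos hc, div_le_iff₀ hc]; exact hl
  · rw [curve_im, abs_div, abs_of_pos hc, div_le_iff₀ hc]; exact hm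

lemma abs_one_sub_le {s ε : ℝ} (hs : 0 < s) (h : |s ^ 2 - 1| ≤ ε) : |s - 1| ≤ ε := by
  have e : s ^ 2 - 1 = (s - 1) * (s + 1) := by ring
  rw [e, abs_mul, abs_of_pos (by linarith : 0 < s + 1)] at h
  nlinarith [abs_nonneg (s - 1)]

lemma inv_pow_approx {a v : ℝ} (ha : 0 < a) (hv : 0 < v) (h : |v ^ 2 * a ^ 2 - 1| ≤ 1 / 10 ^ 10) :
    |(a ^ 3)⁻¹ - v ^ 3| ≤ 4 / 10 ^ 10 * (a ^ 3)⁻¹ ∧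
      |(a ^ 5)⁻¹ - v ^ 5| ≤ 6 / 10 ^ 10 * (a ^ 5)⁻¹ := by
  have h1 : |v * a - 1| ≤ 1 / 10 ^ 10 := abs_one_sub_le (mul_pos hv ha) (by rwa [mul_pow])
  set s := v * a with hs
  have hv' : v = s * a⁻¹ := by rw [hs, mul_assoc, mul_inv_cancel₀ ha.ne', mul_one]
  obtain ⟨h2, h3⟩ := abs_le.1 h1
  have hs0 : 0 ≤ s := by linarith
  have hs1 : s ≤ 1 + 1 / 10 ^ 10 := by linarith
  have hp (n : ℕ) : s ^ n ≤ (1 + 1 / 10 ^ 10) ^ n := pow_le_pow_left₀ hs0 hs1 n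
  constructor
  · have e : (a ^ 3)⁻¹ - v ^ 3 = (1 - s) * (1 + s + s ^ 2) * (a ^ 3)⁻¹ := by
      rw [hv', mul_pow, inv_pow]; ring
    rw [e, abs_mul, abs_mul, abs_of_pos (by positivity : 0 < (a ^ 3)⁻¹), abs_sub_comm,
      abs_of_nonneg (by positivity : 0 ≤ 1 + s + s ^ 2)]
    refine mul_le_mul_of_nonneg_right ?_ (by positivity)
    have : 1 + s + s ^ 2 ≤ 4 := by have := hp 2; norm_num at this; linarith
    calc _ ≤ 1 / 10 ^ 10 * (4 : ℝ) := by gcongr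
      _ = _ := by norm_num
  · have e : (a ^ 5)⁻¹ - v ^ 5 = (1 - s) * (1 + s + s ^ 2 + s ^ 3 + s ^ 4) * (a ^ 5)⁻¹ := by
      rw [hv', mul_pow, inv_pow]; ring
    rw [e, abs_mul, abs_mul, abs_of_pos (by positivity : 0 < (a ^ 5)⁻¹), abs_sub_comm,
      abs_of_nonneg (by positivity : 0 ≤ 1 + s + s ^ 2 + s ^ 3 + s ^ 4)]
    refine mul_le_mul_of_nonneg_right ?_ (by positivity)
    have : 1 + s + s ^ 2 + s ^ 3 + s ^ 4 ≤ 6 := by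
      have h2 := hp 2
      have h3 := hp 3
      have h4 := hp 4
      norm_num at h2 h3 h4
      linarith
    calc _ ≤ 1 / 10 ^ 10 * (6 : ℝ) := by gcongr
      _ = _ := by norm_num

lemma norm_curve_sq (c : ℝ) (l m : List ℤ) (t : ℝ) :
    ‖curve c l m t‖ ^ 2 = (eval l t / c) ^ 2 + (eval m t / c) ^ 2 := by
  rw [← Complex.normSq_eq_norm_sq, Complex.normSq_apply, curve_re, curve_im]; ring

/-- The upper bound 1.01 for the approximate inverse norm forces the norm to be at least 0.99, since
`(1.01 * 0.99) ^ 2` is below `1 - 10 ^ (-10)`. -/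
lemma inverse_norm_approx {v l m : List ℤ} {t : ℝ} (ht : t ∈ Icc (-1 : ℝ) 1)
    (h1 : SupLe (sub (mul (mul v v) (normSq l m)) [10 ^ 64]) (10 ^ 54))
    (h2 : InfGe v (10 ^ 15)) (h3 : SupLe v (10 ^ 14 * 101)) :
    0 < eval v t / 10 ^ 16 ∧
      |(eval v t / 10 ^ 16) ^ 2 * ‖curve (10 ^ 16) l m t‖ ^ 2 - 1| ≤ 1 / 10 ^ 10 ∧
      99 / 100 ≤ ‖curve (10 ^ 16) l m t‖ := by
  have k1 := h1.abs_le ht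
  have k2 := h2.le ht
  have k3 := (abs_le.1 (h3.abs_le ht)).2
  have p1 : 0 < eval v t / 10 ^ 16 := by push_cast at k2; exact div_pos (by linarith) (by norm_num)
  have p2 : |(eval v t / 10 ^ 16) ^ 2 * ‖curve (10 ^ 16) l m t‖ ^ 2 - 1| ≤ 1 / 10 ^ 10 := by
    have e : (eval v t / 10 ^ 16) ^ 2 * ‖curve (10 ^ 16) l m t‖ ^ 2 - 1 =
        eval (sub (mul (mul v v) (normSq l m)) [10 ^ 64]) t / 10 ^ 64 := by
      rw [norm_curve_sq]
      simp only [normSq, eval_sub, eval_mul, eval_add, eval_cons, eval_nil]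
      push_cast
      ring
    rw [e, abs_div, abs_of_pos (by positivity : (0 : ℝ) < 10 ^ 64), div_le_iff₀ (by positivity)]
    refine k1.trans ?_
    push_cast
    norm_num
  refine ⟨p1, p2, ?_⟩
  have p3 : eval v t / 10 ^ 16 ≤ 101 / 100 := by
    rw [div_le_iff₀ (by positivity)]; refine k3.trans ?_; push_cast; norm_num
  by_contra! h
  have p4 := (abs_le.1 p2).1
  have p5 : (eval v t / 10 ^ 16) ^ 2 * ‖curve (10 ^ 16) l m t‖ ^ 2 ≤
      (101 / 100) ^ 2 * (99 / 100) ^ 2 := by gcongr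
  norm_num at p5 p4
  linarith

/-- The approximate orbit of the body `Y`. -/
noncomputable def approxY : ℝ → ℂ := curve (10 ^ 16) yRe yIm

/-- The approximate velocity of the body `Y`. -/
noncomputable def approxVel : ℝ → ℂ := curve (10 ^ 16) (der yRe) (der yIm)

/-- The approximate acceleration of the body `Y`. -/
noncomputable def approxAcc : ℝ → ℂ := curve (10 ^ 16) (der (der yRe)) (der (der yIm))

/-- The approximate difference of the bodies `Y` and `X`. -/
noncomputable def approxA (t : ℝ) : ℂ := 2 * approxY t - approxY (-t)

/-- The approximate difference of the bodies `Y` and `Z`. -/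
noncomputable def approxD (t : ℝ) : ℂ := approxY t + approxY (-t)

/-- The approximate variational solutions. -/
noncomputable def lin (k : Fin 4) : ℝ → ℂ := curve (10 ^ 9) (linRe k) (linIm k)

/-- The velocities of the approximate variational solutions. -/
noncomputable def linVel (k : Fin 4) : ℝ → ℂ := curve (10 ^ 9) (der (linRe k)) (der (linIm k))

/-- The accelerations of the approximate variational solutions. -/
noncomputable def linAcc (k : Fin 4) : ℝ → ℂ :=
  curve (10 ^ 9) (der (der (linRe k))) (der (der (linIm k)))

lemma hasDerivAt_approxY (t : ℝ) : HasDerivAt approxY (approxVel t) t := hasDerivAt_curve _ _ _ t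

lemma hasDerivAt_approxVel (t : ℝ) : HasDerivAt approxVel (approxAcc t) t :=
  hasDerivAt_curve _ _ _ t

lemma hasDerivAt_lin (k : Fin 4) (t : ℝ) : HasDerivAt (lin k) (linVel k t) t :=
  hasDerivAt_curve _ _ _ t

lemma hasDerivAt_linVel (k : Fin 4) (t : ℝ) : HasDerivAt (linVel k) (linAcc k t) t :=
  hasDerivAt_curve _ _ _ t

lemma approxA_eq (t : ℝ) : approxA t = curve (10 ^ 16) (pairA yRe) (pairA yIm) t :=
  (curve_pairA _ _ _ t).symm

lemma approxD_eq (t : ℝ) : approxD t = curve (10 ^ 16) (pairD yRe) (pairD yIm) t :=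
  (curve_pairD _ _ _ t).symm

lemma approxA_large {t : ℝ} (ht : t ∈ Icc (-1 : ℝ) 1) : 99 / 100 ≤ ‖approxA t‖ := by
  rw [approxA_eq]; exact (inverse_norm_approx ht invA_sup invA_pos invA_le).2.2

lemma approxD_large {t : ℝ} (ht : t ∈ Icc (-1 : ℝ) 1) : 99 / 100 ≤ ‖approxD t‖ := by
  rw [approxD_eq]; exact (inverse_norm_approx ht invD_sup invD_pos invD_le).2.2

lemma force_coord_approx {v : List ℤ} {z : ℂ} {t x : ℝ} (h0 : 0 < eval v t / 10 ^ 16)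
    (h : |(eval v t / 10 ^ 16) ^ 2 * ‖z‖ ^ 2 - 1| ≤ 1 / 10 ^ 10) (hz : 99 / 100 ≤ ‖z‖)
    (hx : |x| ≤ ‖z‖) :
    |(‖z‖ ^ 3)⁻¹ * x - (eval v t / 10 ^ 16) ^ 3 * x| ≤ 45 / 10 ^ 11 := by
  have ha : 0 < ‖z‖ := by linarith
  have h1 := (inv_pow_approx ha h0 h).1
  rw [← sub_mul, abs_mul]
  have h2 : (‖z‖ ^ 3)⁻¹ * ‖z‖ ≤ 108 / 100 := by
    rw [pow_succ, mul_inv, mul_assoc, inv_mul_cancel₀ ha.ne', mul_one]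
    rw [inv_le_comm₀ (by positivity) (by norm_num)]
    nlinarith
  calc _ ≤ 4 / 10 ^ 10 * (‖z‖ ^ 3)⁻¹ * ‖z‖ := by gcongr
    _ = 4 / 10 ^ 10 * ((‖z‖ ^ 3)⁻¹ * ‖z‖) := by ring
    _ ≤ 4 / 10 ^ 10 * (108 / 100) := by gcongr
    _ ≤ _ := by norm_num

/-- Since X = -Y - Z and Z(t) = -Y(-t), the differences Y - X and Y - Z involve only Y at `t` and
`-t`. Newton's equation for Y on `[-1, 1]` thus encodes all three bodies on `[0, 1]`. -/
lemma approx_residual {t : ℝ} (ht : t ∈ Icc (-1 : ℝ) 1) :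
    ‖approxAcc t + truncForce (approxA t) + truncForce (approxD t)‖ ≤ 2 / 10 ^ 9 := by
  obtain ⟨a1, a2, a3⟩ := inverse_norm_approx ht invA_sup invA_pos invA_le
  obtain ⟨d1, d2, d3⟩ := inverse_norm_approx ht invD_sup invD_pos invD_le
  have key {l : List ℤ} (h : SupLe (residual l) (10 ^ 54)) : |eval (der (der l)) t / 10 ^ 16 +
      (eval invA t / 10 ^ 16) ^ 3 * (eval (pairA l) t / 10 ^ 16) +
      (eval invD t / 10 ^ 16) ^ 3 * (eval (pairD l) t / 10 ^ 16)| ≤ 1 / 10 ^ 10 := by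
    have h1 := h.abs_le ht
    have e : eval (der (der l)) t / 10 ^ 16 +
      (eval invA t / 10 ^ 16) ^ 3 * (eval (pairA l) t / 10 ^ 16) +
      (eval invD t / 10 ^ 16) ^ 3 * (eval (pairD l) t / 10 ^ 16) =
        eval (residual l) t / 10 ^ 64 := by
      simp only [residual, cube, eval_smul, eval_mul, eval_add]
      push_cast
      ring
    rw [e, abs_div, abs_of_pos (by positivity : (0 : ℝ) < 10 ^ 64), div_le_iff₀ (by positivity)]
    refine h1.trans ?_
    push_cast
    norm_num
  rw [approxA_eq, approxD_eq, truncForce_of_le (by linarith), truncForce_of_le (by linarith)]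
  refine (Complex.norm_le_abs_re_add_abs_im _).trans ?_
  simp only [Complex.add_re, Complex.add_im, Complex.smul_re, Complex.smul_im, smul_eq_mul,
    approxAcc]
  have a4 := force_coord_approx a1 a2 a3 (Complex.abs_re_le_norm _)
  have a5 := force_coord_approx a1 a2 a3 (Complex.abs_im_le_norm _)
  have d4 := force_coord_approx d1 d2 d3 (Complex.abs_re_le_norm _)
  have d5 := force_coord_approx d1 d2 d3 (Complex.abs_im_le_norm _)
  have k1 := key residual_re
  have k2 := key residual_im
  simp only [curve_re, curve_im] at a4 a5 d4 d5 ⊢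
  rw [abs_le] at a4 a5 d4 d5 k1 k2
  have r1 := abs_le.2 (⟨by linarith [a4.1, d4.1, k1.1], by linarith [a4.2, d4.2, k1.2]⟩ :
    -(1 / 10 ^ 9) ≤ eval (der (der yRe)) t / 10 ^ 16 +
      (‖curve (10 ^ 16) (pairA yRe) (pairA yIm) t‖ ^ 3)⁻¹ * (eval (pairA yRe) t / 10 ^ 16) +
      (‖curve (10 ^ 16) (pairD yRe) (pairD yIm) t‖ ^ 3)⁻¹ * (eval (pairD yRe) t / 10 ^ 16) ∧ _ ≤ _)
  have r2 := abs_le.2 (⟨by linarith [a5.1, d5.1, k2.1], by linarith [a5.2, d5.2, k2.2]⟩ :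
    -(1 / 10 ^ 9) ≤ eval (der (der yIm)) t / 10 ^ 16 +
      (‖curve (10 ^ 16) (pairA yRe) (pairA yIm) t‖ ^ 3)⁻¹ * (eval (pairA yIm) t / 10 ^ 16) +
      (‖curve (10 ^ 16) (pairD yRe) (pairD yIm) t‖ ^ 3)⁻¹ * (eval (pairD yIm) t / 10 ^ 16) ∧ _ ≤ _)
  linarith

end FigureEightData

/-! ### Residuals and bounds of the variational solutions -/

namespace FigureEightData
open IntPoly

lemma sq_coord_le {l : List ℤ} {t : ℝ} (ht : t ∈ Icc (-1 : ℝ) 1)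
    (h : SupLe (mul l l) (20 * 10 ^ 32)) : (eval l t / 10 ^ 16) ^ 2 ≤ 20 := by
  have h1 := (abs_le.1 (h.abs_le ht)).2
  rw [eval_mul] at h1
  push_cast at h1
  rw [div_pow, div_le_iff₀ (by positivity)]
  nlinarith

lemma fifth_approx {v k : List ℤ} {t : ℝ} (ht : t ∈ Icc (-1 : ℝ) 1)
    (h : SupLe (sub (fifth v) (smul (10 ^ 71) k)) (10 ^ 73)) :
    |(eval v t / 10 ^ 16) ^ 5 - eval k t / 10 ^ 9| ≤ 1 / 10 ^ 7 := by
  have e : (eval v t / 10 ^ 16) ^ 5 - eval k t / 10 ^ 9 =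
      eval (sub (fifth v) (smul (10 ^ 71) k)) t / 10 ^ 80 := by
    simp only [fifth, cube, eval_sub, eval_smul, eval_mul]
    push_cast
    ring
  rw [e, abs_div, abs_of_pos (by positivity : (0 : ℝ) < 10 ^ 80), div_le_iff₀ (by positivity)]
  refine (h.abs_le ht).trans ?_
  push_cast
  norm_num

/-- The bound 60 on `x` covers both kinds of entries, `q ^ 2 - 2 * p ^ 2` and `-3 * p * q`, when `p
^ 2` and `q ^ 2` are at most 20. -/
lemma entry_approx {a v k x m : ℝ} (ha : 99 / 100 ≤ a) (hv : 0 < v)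
    (h : |v ^ 2 * a ^ 2 - 1| ≤ 1 / 10 ^ 10) (hk : |v ^ 5 - k| ≤ 1 / 10 ^ 7) (hx : |x| ≤ 60)
    (hm : |k * x - m| ≤ 1 / 10 ^ 6) : |(a ^ 5)⁻¹ * x - m| ≤ 1 / 10 ^ 5 := by
  have ha0 : 0 < a := by linarith
  have h1 := (inv_pow_approx ha0 hv h).2
  have h2 : (a ^ 5)⁻¹ ≤ 2 := by
    rw [inv_le_comm₀ (by positivity) (by norm_num)]
    calc (2 : ℝ)⁻¹ ≤ (99 / 100) ^ 5 := by norm_num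
      _ ≤ a ^ 5 := by gcongr
  have h3 : |(a ^ 5)⁻¹ - k| ≤ 12 / 10 ^ 10 + 1 / 10 ^ 7 := by
    have := abs_sub_le ((a ^ 5)⁻¹) (v ^ 5) k
    linarith
  have h4 : |((a ^ 5)⁻¹ - k) * x| ≤ (12 / 10 ^ 10 + 1 / 10 ^ 7) * 60 := by
    rw [abs_mul]; gcongr
  have e : (a ^ 5)⁻¹ * x - m = ((a ^ 5)⁻¹ - k) * x + (k * x - m) := by ring
  rw [e]
  refine (abs_add_le _ _).trans ((add_le_add h4 hm).trans (by norm_num))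

lemma diag_approx {v k p q m : List ℤ} {t a : ℝ} (ht : t ∈ Icc (-1 : ℝ) 1) (ha : 99 / 100 ≤ a)
    (hv : 0 < eval v t / 10 ^ 16) (h : |(eval v t / 10 ^ 16) ^ 2 * a ^ 2 - 1| ≤ 1 / 10 ^ 10)
    (hk : SupLe (sub (fifth v) (smul (10 ^ 71) k)) (10 ^ 73))
    (hm : SupLe (diagError k p q m) (10 ^ 35))
    (hp : SupLe (mul p p) (20 * 10 ^ 32)) (hq : SupLe (mul q q) (20 * 10 ^ 32)) :
    |(a ^ 5)⁻¹ * ((eval q t / 10 ^ 16) ^ 2 - 2 * (eval p t / 10 ^ 16) ^ 2) - eval m t / 10 ^ 9| ≤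
      1 / 10 ^ 5 := by
  refine entry_approx ha hv h (fifth_approx ht hk) ?_ ?_
  · rw [abs_le]
    constructor <;> nlinarith [sq_coord_le ht hp, sq_coord_le ht hq,
      sq_nonneg (eval p t / 10 ^ 16), sq_nonneg (eval q t / 10 ^ 16)]
  · have e : eval k t / 10 ^ 9 * ((eval q t / 10 ^ 16) ^ 2 - 2 * (eval p t / 10 ^ 16) ^ 2) -
        eval m t / 10 ^ 9 = eval (diagError k p q m) t / 10 ^ 41 := by
      simp only [diagError, eval_sub, eval_smul, eval_mul]
      push_cast
      ring
    rw [e, abs_div, abs_of_pos (by positivity : (0 : ℝ) < 10 ^ 41), div_le_iff₀ (by positivity)]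
    refine (hm.abs_le ht).trans ?_
    push_cast
    norm_num

lemma offDiag_approx {v k p q m : List ℤ} {t a : ℝ} (ht : t ∈ Icc (-1 : ℝ) 1) (ha : 99 / 100 ≤ a)
    (hv : 0 < eval v t / 10 ^ 16) (h : |(eval v t / 10 ^ 16) ^ 2 * a ^ 2 - 1| ≤ 1 / 10 ^ 10)
    (hk : SupLe (sub (fifth v) (smul (10 ^ 71) k)) (10 ^ 73))
    (hm : SupLe (offDiagError k p q m) (10 ^ 35))
    (hp : SupLe (mul p p) (20 * 10 ^ 32)) (hq : SupLe (mul q q) (20 * 10 ^ 32)) :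
    |(a ^ 5)⁻¹ * (-3 * (eval p t / 10 ^ 16) * (eval q t / 10 ^ 16)) - eval m t / 10 ^ 9| ≤
      1 / 10 ^ 5 := by
  refine entry_approx ha hv h (fifth_approx ht hk) ?_ ?_
  · rw [abs_le]
    constructor <;> nlinarith [sq_coord_le ht hp, sq_coord_le ht hq,
      sq_nonneg (eval p t / 10 ^ 16 - eval q t / 10 ^ 16),
      sq_nonneg (eval p t / 10 ^ 16 + eval q t / 10 ^ 16)]
  · have e : eval k t / 10 ^ 9 * (-3 * (eval p t / 10 ^ 16) * (eval q t / 10 ^ 16)) -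
        eval m t / 10 ^ 9 = eval (offDiagError k p q m) t / 10 ^ 41 := by
      simp only [offDiagError, eval_sub, eval_smul, eval_mul]
      push_cast
      ring
    rw [e, abs_div, abs_of_pos (by positivity : (0 : ℝ) < 10 ^ 41), div_le_iff₀ (by positivity)]
    refine (hm.abs_le ht).trans ?_
    push_cast
    norm_num

lemma forceDeriv_re (z w : ℂ) : (forceDeriv z w).re =
    (‖z‖ ^ 5)⁻¹ * (z.im ^ 2 - 2 * z.re ^ 2) * w.re + (‖z‖ ^ 5)⁻¹ * (-3 * z.re * z.im) * w.im := by
  have h : ‖z‖ ^ 2 = z.re ^ 2 + z.im ^ 2 := by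
    rw [← Complex.normSq_eq_norm_sq, Complex.normSq_apply]; ring
  simp only [forceDeriv, h, Complex.smul_re, Complex.sub_re, smul_eq_mul]
  ring

lemma forceDeriv_im (z w : ℂ) : (forceDeriv z w).im =
    (‖z‖ ^ 5)⁻¹ * (z.re ^ 2 - 2 * z.im ^ 2) * w.im + (‖z‖ ^ 5)⁻¹ * (-3 * z.im * z.re) * w.re := by
  have h : ‖z‖ ^ 2 = z.re ^ 2 + z.im ^ 2 := by
    rw [← Complex.normSq_eq_norm_sq, Complex.normSq_apply]; ring
  simp only [forceDeriv, h, Complex.smul_im, Complex.sub_im, smul_eq_mul]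
  ring

lemma neg_mem_Icc {t : ℝ} (ht : t ∈ Icc (-1 : ℝ) 1) : -t ∈ Icc (-1 : ℝ) 1 :=
  ⟨by linarith [ht.2], by linarith [ht.1]⟩

lemma linRe_bound (k : Fin 4) {t : ℝ} (ht : t ∈ Icc (-1 : ℝ) 1) :
    |eval (linRe k) t / 10 ^ 9| ≤ 2 := by
  rw [abs_div, abs_of_pos (by positivity : (0 : ℝ) < 10 ^ 9), div_le_iff₀ (by positivity)]
  refine ((linRe_le k).abs_le ht).trans ?_
  fin_cases k <;> simp <;> norm_num

lemma linIm_bound (k : Fin 4) {t : ℝ} (ht : t ∈ Icc (-1 : ℝ) 1) :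
    |eval (linIm k) t / 10 ^ 9| ≤ 2 := by
  rw [abs_div, abs_of_pos (by positivity : (0 : ℝ) < 10 ^ 9), div_le_iff₀ (by positivity)]
  refine ((linIm_le k).abs_le ht).trans ?_
  fin_cases k <;> simp <;> norm_num

lemma tidal_sum_le {y e₁ e₂ e₃ e₄ m₁ m₂ m₃ m₄ x₁ x₂ x₃ x₄ : ℝ}
    (h : |y + (m₁ * x₁ + m₂ * x₂) + (m₃ * x₃ + m₄ * x₄)| ≤ 1 / 10 ^ 4)
    (h₁ : |e₁ - m₁| ≤ 1 / 10 ^ 5) (h₂ : |e₂ - m₂| ≤ 1 / 10 ^ 5) (h₃ : |e₃ - m₃| ≤ 1 / 10 ^ 5)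
    (h₄ : |e₄ - m₄| ≤ 1 / 10 ^ 5) (k₁ : |x₁| ≤ 6) (k₂ : |x₂| ≤ 6) (k₃ : |x₃| ≤ 6)
    (k₄ : |x₄| ≤ 6) : |y + (e₁ * x₁ + e₂ * x₂) + (e₃ * x₃ + e₄ * x₄)| ≤ 5 / 10 ^ 4 := by
  have key {e m x : ℝ} (h : |e - m| ≤ 1 / 10 ^ 5) (k : |x| ≤ 6) :
      |(e - m) * x| ≤ 1 / 10 ^ 5 * 6 := by rw [abs_mul]; gcongr
  have r₁ := abs_le.1 (key h₁ k₁)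
  have r₂ := abs_le.1 (key h₂ k₂)
  have r₃ := abs_le.1 (key h₃ k₃)
  have r₄ := abs_le.1 (key h₄ k₄)
  rw [abs_le] at h ⊢
  constructor <;> linarith [r₁.1, r₂.1, r₃.1, r₄.1, r₁.2, r₂.2, r₃.2, r₄.2, h.1, h.2]

lemma lin_residual (k : Fin 4) {t : ℝ} (ht : t ∈ Icc (-1 : ℝ) 1) :
    ‖linAcc k t + forceDeriv (approxA t) (2 * lin k t - lin k (-t)) +
      forceDeriv (approxD t) (lin k t + lin k (-t))‖ ≤ 1 / 10 ^ 3 := by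
  obtain ⟨a1, a2, a3⟩ := inverse_norm_approx ht invA_sup invA_pos invA_le
  obtain ⟨d1, d2, d3⟩ := inverse_norm_approx ht invD_sup invD_pos invD_le
  have key {a b c d l m : List ℤ} (h : SupLe (linResidual a b c d l m) (10 ^ 14)) :
      |eval (der (der l)) t / 10 ^ 9 + (eval a t / 10 ^ 9 * (eval (pairA l) t / 10 ^ 9) +
      eval b t / 10 ^ 9 * (eval (pairA m) t / 10 ^ 9)) +
      (eval c t / 10 ^ 9 * (eval (pairD l) t / 10 ^ 9) +
      eval d t / 10 ^ 9 * (eval (pairD m) t / 10 ^ 9))| ≤ 1 / 10 ^ 4 := by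
    have e : eval (der (der l)) t / 10 ^ 9 + (eval a t / 10 ^ 9 * (eval (pairA l) t / 10 ^ 9) +
      eval b t / 10 ^ 9 * (eval (pairA m) t / 10 ^ 9)) +
      (eval c t / 10 ^ 9 * (eval (pairD l) t / 10 ^ 9) +
      eval d t / 10 ^ 9 * (eval (pairD m) t / 10 ^ 9)) =
        eval (linResidual a b c d l m) t / 10 ^ 18 := by
      simp only [linResidual, eval_smul, eval_mul, eval_add]
      push_cast
      ring
    rw [e, abs_div, abs_of_pos (by positivity : (0 : ℝ) < 10 ^ 18), div_le_iff₀ (by positivity)]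
    refine (h.abs_le ht).trans ?_
    push_cast
    norm_num
  have bA {l : List ℤ} (h : ∀ s ∈ Icc (-1 : ℝ) 1, |eval l s / 10 ^ 9| ≤ 2) :
      |eval (pairA l) t / 10 ^ 9| ≤ 6 := by
    have h1 := abs_le.1 (h t ht)
    have h2 := abs_le.1 (h (-t) (neg_mem_Icc ht))
    rw [eval_pairA, sub_div, mul_div_assoc, abs_le]
    constructor <;> linarith [h1.1, h1.2, h2.1, h2.2]
  have bD {l : List ℤ} (h : ∀ s ∈ Icc (-1 : ℝ) 1, |eval l s / 10 ^ 9| ≤ 2) :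
      |eval (pairD l) t / 10 ^ 9| ≤ 6 := by
    have h1 := abs_le.1 (h t ht)
    have h2 := abs_le.1 (h (-t) (neg_mem_Icc ht))
    rw [eval_pairD, add_div, abs_le]
    constructor <;> linarith [h1.1, h1.2, h2.1, h2.2]
  have bRe := fun s hs => linRe_bound k (t := s) hs
  have bIm := fun s hs => linIm_bound k (t := s) hs
  rw [approxA_eq, approxD_eq, lin, ← curve_pairA, ← curve_pairD, linAcc]
  refine (Complex.norm_le_abs_re_add_abs_im _).trans ?_
  have r1 := tidal_sum_le (key (linResidual_re k))
    (diag_approx ht a3 a1 a2 invFifthA_sup tideA11_sup sqA_re_le sqA_im_le)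
    (offDiag_approx ht a3 a1 a2 invFifthA_sup tideA12_sup sqA_re_le sqA_im_le)
    (diag_approx ht d3 d1 d2 invFifthD_sup tideD11_sup sqD_re_le sqD_im_le)
    (offDiag_approx ht d3 d1 d2 invFifthD_sup tideD12_sup sqD_re_le sqD_im_le)
    (bA bRe) (bA bIm) (bD bRe) (bD bIm)
  have r2 := tidal_sum_le (key (linResidual_im k))
    (diag_approx ht a3 a1 a2 invFifthA_sup tideA22_sup sqA_im_le sqA_re_le)
    (offDiag_approx ht a3 a1 a2 invFifthA_sup tideA12_sup sqA_re_le sqA_im_le)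
    (diag_approx ht d3 d1 d2 invFifthD_sup tideD22_sup sqD_im_le sqD_re_le)
    (offDiag_approx ht d3 d1 d2 invFifthD_sup tideD12_sup sqD_re_le sqD_im_le)
    (bA bIm) (bA bRe) (bD bIm) (bD bRe)
  simp only [Complex.add_re, Complex.add_im, forceDeriv_re, forceDeriv_im, curve_re, curve_im]
  refine (add_le_add (r1.trans' (le_of_eq ?_)) (r2.trans' (le_of_eq ?_))).trans (by norm_num)
  · congr 1
  · congr 1; ring

/-- Bounds for the variational solutions. -/
noncomputable def linBound : Fin 4 → ℝ := ![16 / 10, 12 / 10, 23 / 10, 6 / 10]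

/-- Bounds for the velocities of the variational solutions. -/
noncomputable def linVelBound : Fin 4 → ℝ := ![10 / 10, 9 / 10, 17 / 10, 8 / 10]

lemma norm_lin_le (k : Fin 4) {t : ℝ} (ht : t ∈ Icc (-1 : ℝ) 1) : ‖lin k t‖ ≤ linBound k := by
  have h1 := (linRe_le k).abs_le ht
  have h2 := (linIm_le k).abs_le ht
  push_cast at h1 h2
  refine (norm_curve_le (a := (10 ^ 8 * (![4, 8, 19, 2] k : ℤ)) / 10 ^ 9)
    (b := (10 ^ 8 * (![12, 4, 4, 4] k : ℤ)) / 10 ^ 9) (by positivity) ?_ ?_).trans ?_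
  · rw [div_mul_cancel₀ _ (by positivity)]; exact h1.trans_eq (by norm_num)
  · rw [div_mul_cancel₀ _ (by positivity)]; exact h2.trans_eq (by norm_num)
  · fin_cases k <;> simp [linBound] <;> norm_num

lemma norm_linVel_le (k : Fin 4) {t : ℝ} (ht : t ∈ Icc (-1 : ℝ) 1) :
    ‖linVel k t‖ ≤ linVelBound k := by
  have h1 := (der_linRe_le k).abs_le ht
  have h2 := (der_linIm_le k).abs_le ht
  push_cast at h1 h2
  refine (norm_curve_le (a := (10 ^ 8 * (![5, 4, 12, 3] k : ℤ)) / 10 ^ 9)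
    (b := (10 ^ 8 * (![5, 5, 5, 5] k : ℤ)) / 10 ^ 9) (by positivity) ?_ ?_).trans ?_
  · rw [div_mul_cancel₀ _ (by positivity)]; exact h1.trans_eq (by norm_num)
  · rw [div_mul_cancel₀ _ (by positivity)]; exact h2.trans_eq (by norm_num)
  · fin_cases k <;> simp [linVelBound] <;> norm_num

end FigureEightData

/-! ### Approximate solutions with the initial symmetry -/

lemma exp_three_le : Real.exp 3 ≤ 201 / 10 := by
  have h : Real.exp 3 = Real.exp 1 ^ 3 := by rw [← Real.exp_nat_mul]; norm_num
  rw [h]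
  calc _ ≤ (2.7182818286 : ℝ) ^ 3 := by
        have := Real.exp_one_lt_d9
        gcongr
    _ ≤ _ := by norm_num

/-- Grönwall's inequality with Lipschitz constant 3 over at most unit time: `δ * exp 3 + ε * (exp 3
- 1) / 3`. -/
lemma norm_sub_le_of_residual {x z z' : ℝ → BodyState} {δ ε : ℝ} (hx : IsTruncSolution x)
    (hz : ∀ t ∈ Icc (0 : ℝ) 1, HasDerivAt z (z' t) t)
    (hres : ∀ t ∈ Icc (0 : ℝ) 1, ‖z' t - truncField (z t)‖ ≤ ε) (h0 : ‖x 0 - z 0‖ ≤ δ)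
    {t : ℝ} (ht : t ∈ Icc (0 : ℝ) 1) : ‖x t - z t‖ ≤ 201 / 10 * δ + 64 / 10 * ε := by
  have hδ : 0 ≤ δ := (norm_nonneg _).trans h0
  have hε : 0 ≤ ε := (norm_nonneg _).trans (hres 0 (by simp))
  have h := dist_le_of_approx_trajectories_ODE (v := fun _ => truncField) (a := 0) (b := 1)
    (f := x) (g := z) (εf := 0) (εg := ε) (δ := δ)
    (fun _ => truncField_lipschitz) (fun t _ => (hx t).continuousAt.continuousWithinAt)
    (fun t _ => (hx t).hasDerivWithinAt) (fun t _ => by rw [dist_self])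
    (fun t ht => (hz t ht).continuousAt.continuousWithinAt)
    (fun t ht => (hz t (Ico_subset_Icc_self ht)).hasDerivWithinAt)
    (fun t ht => by rw [dist_eq_norm]; exact hres t (Ico_subset_Icc_self ht))
    (by rwa [dist_eq_norm]) t ht
  rw [dist_eq_norm, zero_add, sub_zero] at h
  refine (h.trans (gronwallBound_mono hδ hε (NNReal.coe_nonneg _) ht.2)).trans ?_
  rw [gronwallBound_of_K_ne_0 (by norm_num)]
  have := exp_three_le
  simp only [NNReal.coe_ofNat, mul_one]
  have h1 : δ * Real.exp 3 ≤ δ * (201 / 10) := by gcongr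
  have h2 : ε / 3 * (Real.exp 3 - 1) ≤ ε / 3 * (201 / 10 - 1) := by gcongr
  linarith

lemma norm_bodyState_le {s : BodyState} {C : ℝ} (h₁ : ∀ i, ‖s.1 i‖ ≤ C) (h₂ : ∀ i, ‖s.2 i‖ ≤ C) :
    ‖s‖ ≤ C := by
  have hC : 0 ≤ C := (norm_nonneg _).trans (h₁ 0)
  exact max_le ((pi_norm_le_iff_of_nonneg hC).2 h₁) ((pi_norm_le_iff_of_nonneg hC).2 h₂)

lemma norm_pos_le (s : BodyState) (i : Fin 3) : ‖s.1 i‖ ≤ ‖s‖ :=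
  (norm_le_pi_norm s.1 i).trans (norm_fst_le s)

lemma norm_vel_le (s : BodyState) (i : Fin 3) : ‖s.2 i‖ ≤ ‖s‖ :=
  (norm_le_pi_norm s.2 i).trans (norm_snd_le s)

/-- The state of the three bodies `Z`, `Y`, `X` for which `Y` has the position `y` and the velocity
`v`, `Z (t) = -Y (-t)`, and the centre of mass is at rest in the origin. -/
noncomputable def symState (y v : ℝ → ℂ) (t : ℝ) : BodyState :=
  (![-y (-t), y t, y (-t) - y t],
    ![(3 : ℝ)⁻¹ • v (-t), (3 : ℝ)⁻¹ • v t, -((3 : ℝ)⁻¹ • (v t + v (-t)))])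

/-- The derivative of `symState`. -/
noncomputable def symStateDeriv (v a : ℝ → ℂ) (t : ℝ) : BodyState :=
  (![v (-t), v t, -(v t + v (-t))],
    ![-((3 : ℝ)⁻¹ • a (-t)), (3 : ℝ)⁻¹ • a t, -((3 : ℝ)⁻¹ • (a t - a (-t)))])

lemma hasDerivAt_symState {y v a : ℝ → ℂ} (hy : ∀ t, HasDerivAt y (v t) t)
    (hv : ∀ t, HasDerivAt v (a t) t) (t : ℝ) :
    HasDerivAt (symState y v) (symStateDeriv v a t) t := by
  have hr {f : ℝ → ℂ} {f' : ℂ} (h : HasDerivAt f f' (-t)) :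
      HasDerivAt (fun t => f (-t)) (-f') t := by
    simpa [Function.comp_def] using h.scomp t (hasDerivAt_neg t)
  refine (hasDerivAt_pi.2 fun i => ?_).prodMk (hasDerivAt_pi.2 fun i => ?_) <;> fin_cases i
  · exact (hr (hy (-t))).neg.congr_deriv (by simp)
  · exact hy t
  · exact ((hr (hy (-t))).sub (hy t)).congr_deriv (by simp; ring)
  · exact ((hr (hv (-t))).const_smul (3 : ℝ)⁻¹).congr_deriv (by simp)
  · exact (hv t).const_smul (3 : ℝ)⁻¹
  · exact (((hv t).add (hr (hv (-t)))).const_smul (3 : ℝ)⁻¹).neg.congr_deriv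
      (by simp [sub_eq_add_neg])

lemma truncAcc_eq (q : Fin 3 → ℂ) : truncAcc q =
    ![truncForce (q 1 - q 0) + truncForce (q 2 - q 0),
      -truncForce (q 1 - q 2) - truncForce (q 1 - q 0),
      truncForce (q 1 - q 2) - truncForce (q 2 - q 0)] := by
  funext i
  simp only [truncAcc, Fin.sum_univ_three]
  fin_cases i
  · simp [truncForce_zero]
  · simp only [Fin.mk_one, sub_self, truncForce_zero, add_zero]
    rw [← neg_sub (q 1) (q 0), ← neg_sub (q 1) (q 2), truncForce_neg, truncForce_neg]
    simp; ring
  · simp only [Fin.reduceFinMk, sub_self, truncForce_zero, add_zero]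
    rw [← neg_sub (q 2) (q 0), truncForce_neg]
    simp; ring

lemma norm_sym_comb_le {a b C : ℝ} {u v : ℂ} (hu : ‖u‖ ≤ a) (hv : ‖v‖ ≤ a) (h : 2 * a ≤ b)
    (hb : 3⁻¹ * b ≤ C) :
    ‖(3 : ℝ)⁻¹ • u‖ ≤ C ∧ ‖(3 : ℝ)⁻¹ • (u + v)‖ ≤ C := by
  have h0 : 0 ≤ a := (norm_nonneg _).trans hu
  rw [norm_smul, norm_smul, Real.norm_of_nonneg (by norm_num)]
  have := norm_add_le u v
  constructor <;> linarith

namespace FigureEightData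
open IntPoly

/-- The approximate figure-eight solution. -/
noncomputable def approxState : ℝ → BodyState := symState approxY approxVel

/-- Combination of the variational solutions. -/
noncomputable def linY (c : Fin 4 → ℝ) (t : ℝ) : ℂ := ∑ k, c k • lin k t

/-- Velocity of a combination of the variational solutions. -/
noncomputable def linV (c : Fin 4 → ℝ) (t : ℝ) : ℂ := ∑ k, c k • linVel k t

/-- Acceleration of a combination of the variational solutions. -/
noncomputable def linA (c : Fin 4 → ℝ) (t : ℝ) : ℂ := ∑ k, c k • linAcc k t

/-- Combination of the variational solutions, as a variation of the state of the three bodies. -/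
noncomputable def linState (c : Fin 4 → ℝ) : ℝ → BodyState := symState (linY c) (linV c)

lemma norm_linComb_le {f : Fin 4 → ℂ} {b : Fin 4 → ℝ} (h : ∀ k, ‖f k‖ ≤ b k) (c : Fin 4 → ℝ) :
    ‖∑ k, c k • f k‖ ≤ (∑ k, b k) * ‖c‖ := by
  rw [Finset.sum_mul]
  refine norm_sum_le_of_le _ fun k _ => ?_
  rw [norm_smul, mul_comm]
  exact mul_le_mul (h k) (norm_le_pi_norm c k) (norm_nonneg _) ((norm_nonneg _).trans (h k))

lemma norm_linY_le (c : Fin 4 → ℝ) {t : ℝ} (ht : t ∈ Icc (-1 : ℝ) 1) :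
    ‖linY c t‖ ≤ 57 / 10 * ‖c‖ := by
  refine (norm_linComb_le (fun k => norm_lin_le k ht) c).trans (le_of_eq ?_)
  simp [linBound, Fin.sum_univ_four]
  norm_num

lemma norm_linV_le (c : Fin 4 → ℝ) {t : ℝ} (ht : t ∈ Icc (-1 : ℝ) 1) :
    ‖linV c t‖ ≤ 44 / 10 * ‖c‖ := by
  refine (norm_linComb_le (fun k => norm_linVel_le k ht) c).trans (le_of_eq ?_)
  simp [linVelBound, Fin.sum_univ_four]
  norm_num

lemma hasDerivAt_linY (c : Fin 4 → ℝ) (t : ℝ) : HasDerivAt (linY c) (linV c t) t :=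
  HasDerivAt.fun_sum fun k _ => (hasDerivAt_lin k t).const_smul (c k)

lemma hasDerivAt_linV (c : Fin 4 → ℝ) (t : ℝ) : HasDerivAt (linV c) (linA c t) t :=
  HasDerivAt.fun_sum fun k _ => (hasDerivAt_linVel k t).const_smul (c k)

lemma forceDeriv_add (z u v : ℂ) : forceDeriv z (u + v) = forceDeriv z u + forceDeriv z v := by
  apply Complex.ext <;> simp [forceDeriv_re, forceDeriv_im] <;> ring

lemma forceDeriv_smul (z : ℂ) (c : ℝ) (u : ℂ) : forceDeriv z (c • u) = c • forceDeriv z u := by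
  apply Complex.ext <;> simp [forceDeriv_re, forceDeriv_im] <;> ring

lemma forceDeriv_sum (z : ℂ) (c : Fin 4 → ℝ) (f : Fin 4 → ℂ) :
    forceDeriv z (∑ k, c k • f k) = ∑ k, c k • forceDeriv z (f k) := by
  simp only [Fin.sum_univ_four, forceDeriv_add, forceDeriv_smul]

/-- The variation of `Y - X`. -/
noncomputable def linPairA (c : Fin 4 → ℝ) (t : ℝ) : ℂ := 2 * linY c t - linY c (-t)

/-- The variation of `Y - Z`. -/
noncomputable def linPairD (c : Fin 4 → ℝ) (t : ℝ) : ℂ := linY c t + linY c (-t)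

lemma norm_linPairA_le (c : Fin 4 → ℝ) {t : ℝ} (ht : t ∈ Icc (-1 : ℝ) 1) :
    ‖linPairA c t‖ ≤ 171 / 10 * ‖c‖ := by
  have h1 := norm_linY_le c ht
  have h2 := norm_linY_le c (neg_mem_Icc ht)
  refine (norm_sub_le _ _).trans ?_
  rw [norm_mul, Complex.norm_ofNat]
  linarith

lemma norm_linPairD_le (c : Fin 4 → ℝ) {t : ℝ} (ht : t ∈ Icc (-1 : ℝ) 1) :
    ‖linPairD c t‖ ≤ 171 / 10 * ‖c‖ := by
  have h1 := norm_linY_le c ht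
  have h2 := norm_linY_le c (neg_mem_Icc ht)
  refine (norm_add_le _ _).trans ?_
  linarith [norm_nonneg c]

lemma linComb_residual (c : Fin 4 → ℝ) {t : ℝ} (ht : t ∈ Icc (-1 : ℝ) 1) :
    ‖linA c t + forceDeriv (approxA t) (linPairA c t) + forceDeriv (approxD t) (linPairD c t)‖ ≤
      4 / 10 ^ 3 * ‖c‖ := by
  have e1 : linPairA c t = ∑ k, c k • (2 * lin k t - lin k (-t)) := by
    simp only [linPairA, linY, Fin.sum_univ_four, Complex.real_smul]; ring
  have e2 : linPairD c t = ∑ k, c k • (lin k t + lin k (-t)) := by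
    simp only [linPairD, linY, Fin.sum_univ_four, Complex.real_smul]; ring
  have e : linA c t + forceDeriv (approxA t) (linPairA c t) +
      forceDeriv (approxD t) (linPairD c t) = ∑ k, c k • (linAcc k t +
        forceDeriv (approxA t) (2 * lin k t - lin k (-t)) +
        forceDeriv (approxD t) (lin k t + lin k (-t))) := by
    rw [e1, e2, forceDeriv_sum, forceDeriv_sum, linA]
    simp only [Fin.sum_univ_four, smul_add]
    abel
  rw [e]
  refine (norm_linComb_le (fun k => lin_residual k ht) c).trans (le_of_eq ?_)
  simp
  norm_num

lemma norm_linState_le (c : Fin 4 → ℝ) {t : ℝ} (ht : t ∈ Icc (-1 : ℝ) 1) :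
    ‖linState c t‖ ≤ 12 * ‖c‖ := by
  have h0 := norm_nonneg c
  have h1 := norm_linY_le c ht
  have h2 := norm_linY_le c (neg_mem_Icc ht)
  have h3 := norm_linV_le c ht
  have h4 := norm_linV_le c (neg_mem_Icc ht)
  have k1 := norm_sym_comb_le h3 h4 le_rfl (C := 12 * ‖c‖) (by linarith)
  have k2 := norm_sym_comb_le h4 h3 le_rfl (C := 12 * ‖c‖) (by linarith)
  refine norm_bodyState_le (fun i => ?_) (fun i => ?_) <;> fin_cases i
  · simp [linState, symState]; linarith
  · simp [linState, symState]; linarith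
  · have := norm_sub_le (linY c (-t)) (linY c t)
    simp [linState, symState]; linarith
  · exact k2.1
  · exact k1.1
  · exact (norm_neg _).trans_le k1.2

end FigureEightData

lemma truncField_fst {s : BodyState} (h : ∀ i, ‖s.2 i‖ ≤ 1) (i : Fin 3) :
    (truncField s).1 i = (3 : ℝ) • s.2 i := by
  simp only [truncField, truncVel_of_le (h i)]

namespace FigureEightData
open IntPoly

lemma Icc_zero_subset {t : ℝ} (ht : t ∈ Icc (0 : ℝ) 1) : t ∈ Icc (-1 : ℝ) 1 :=
  ⟨by linarith [ht.1], ht.2⟩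

lemma norm_approxVel_le {t : ℝ} (ht : t ∈ Icc (-1 : ℝ) 1) : ‖approxVel t‖ ≤ 2 := by
  have h1 := velY_re_le.abs_le ht
  have h2 := velY_im_le.abs_le ht
  push_cast at h1 h2
  refine (norm_curve_le (a := 1) (b := 1) (by positivity) ?_ ?_).trans (by norm_num)
  · exact h1.trans (by norm_num)
  · exact h2.trans (by norm_num)

lemma norm_approxVel_add_le {t : ℝ} (ht : t ∈ Icc (-1 : ℝ) 1) :
    ‖approxVel t + approxVel (-t)‖ ≤ 29 / 10 := by
  have h1 := velX_re_le.abs_le ht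
  have h2 := velX_im_le.abs_le ht
  push_cast at h1 h2
  rw [approxVel, ← curve_pairD]
  refine (norm_curve_le (a := 15 / 10) (b := 14 / 10) (by positivity) ?_ ?_).trans (by norm_num)
  · exact h1.trans (by norm_num)
  · exact h2.trans (by norm_num)

lemma norm_approxState_vel_le {t : ℝ} (ht : t ∈ Icc (-1 : ℝ) 1) (i : Fin 3) :
    ‖(approxState t).2 i‖ ≤ 29 / 30 := by
  have h1 := norm_approxVel_le ht
  have h2 := norm_approxVel_le (neg_mem_Icc ht)
  have h3 := norm_approxVel_add_le ht
  have e (z : ℂ) : ‖(3 : ℝ)⁻¹ • z‖ = 3⁻¹ * ‖z‖ := by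
    rw [norm_smul, Real.norm_of_nonneg (by norm_num)]
  fin_cases i
  · exact (e _).trans_le (by linarith)
  · exact (e _).trans_le (by linarith)
  · exact ((norm_neg _).trans (e _)).trans_le (by linarith)

lemma approxState_diff_YX (t : ℝ) : (approxState t).1 1 - (approxState t).1 2 = approxA t := by
  simp [approxState, symState, approxA]; ring

lemma approxState_diff_XZ (t : ℝ) : (approxState t).1 2 - (approxState t).1 0 = approxA (-t) := by
  simp [approxState, symState, approxA]; ring

lemma approxState_diff_YZ (t : ℝ) : (approxState t).1 1 - (approxState t).1 0 = approxD t := by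
  simp [approxState, symState, approxD]

lemma linState_diff_YX (c : Fin 4 → ℝ) (t : ℝ) :
    (linState c t).1 1 - (linState c t).1 2 = linPairA c t := by
  simp [linState, symState, linPairA]; ring

lemma linState_diff_XZ (c : Fin 4 → ℝ) (t : ℝ) :
    (linState c t).1 2 - (linState c t).1 0 = linPairA c (-t) := by
  simp [linState, symState, linPairA]; ring

lemma linState_diff_YZ (c : Fin 4 → ℝ) (t : ℝ) :
    (linState c t).1 1 - (linState c t).1 0 = linPairD c t := by
  simp [linState, symState, linPairD]

lemma approxD_neg (t : ℝ) : approxD (-t) = approxD t := by simp [approxD, add_comm]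

lemma linPairD_neg (c : Fin 4 → ℝ) (t : ℝ) : linPairD c (-t) = linPairD c t := by
  simp [linPairD, add_comm]

/-- The derivative of `approxState`. -/
noncomputable def approxStateDeriv : ℝ → BodyState := symStateDeriv approxVel approxAcc

/-- The derivative of `linState`. -/
noncomputable def linStateDeriv (c : Fin 4 → ℝ) : ℝ → BodyState := symStateDeriv (linV c) (linA c)

lemma norm_third_smul_le {z : ℂ} {C : ℝ} (h : ‖z‖ ≤ 3 * C) : ‖(3 : ℝ)⁻¹ • z‖ ≤ C := by
  rw [norm_smul, Real.norm_of_nonneg (by norm_num)]; linarith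

/-- The velocity equations hold exactly. The residuals of Z and Y come from that of Y at `-t` and
`t`, and X collects both: twice `2 / 10 ^ 9`, divided by 3. -/
lemma approxState_residual {t : ℝ} (ht : t ∈ Icc (0 : ℝ) 1) :
    ‖approxStateDeriv t - truncField (approxState t)‖ ≤ 14 / 10 ^ 10 := by
  have ht' := Icc_zero_subset ht
  have h1 := approx_residual ht'
  have h2 := approx_residual (neg_mem_Icc ht')
  rw [approxD_neg] at h2
  refine norm_bodyState_le (fun i => ?_) (fun i => ?_)
  · rw [Prod.fst_sub, Pi.sub_apply,
      truncField_fst fun i => (norm_approxState_vel_le ht' i).trans (by norm_num)]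
    have : (approxStateDeriv t).1 i - (3 : ℝ) • (approxState t).2 i = 0 := by
      fin_cases i <;> simp [approxStateDeriv, symStateDeriv, approxState, symState]
    rw [this, norm_zero]
    norm_num
  · rw [Prod.snd_sub, Pi.sub_apply]
    simp only [truncField, truncAcc_eq, approxState_diff_YX, approxState_diff_XZ,
      approxState_diff_YZ]
    fin_cases i
    · rw [show _ - _ = (3 : ℝ)⁻¹ • -(approxAcc (-t) + truncForce (approxA (-t)) +
        truncForce (approxD t)) by
          simp [approxStateDeriv, symStateDeriv]; ring]
      exact norm_third_smul_le (by rw [norm_neg]; linarith)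
    · rw [show _ - _ = (3 : ℝ)⁻¹ • (approxAcc t + truncForce (approxA t) +
        truncForce (approxD t)) by
          simp [approxStateDeriv, symStateDeriv]; ring]
      exact norm_third_smul_le (by linarith)
    · rw [show _ - _ = (3 : ℝ)⁻¹ • ((approxAcc (-t) + truncForce (approxA (-t)) +
        truncForce (approxD t)) - (approxAcc t + truncForce (approxA t) +
        truncForce (approxD t))) by
          simp [approxStateDeriv, symStateDeriv]; ring]
      refine norm_third_smul_le ((norm_sub_le _ _).trans (by linarith))

lemma pair_error {a₀ a d : ℂ} {c : ℝ} (h₀ : 99 / 100 ≤ ‖a₀‖) (ha : ‖a - a₀‖ ≤ 6 / 10 ^ 5)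
    (hd : ‖d‖ ≤ 171 / 10 * c) (hc : c ≤ 3 / 10 ^ 7) :
    ‖truncForce (a + d) - truncForce a - forceDeriv a₀ d‖ ≤ 9 / 10 ^ 3 * c := by
  have hd' : ‖d‖ ≤ 1 / 10 ^ 5 := by linarith
  have h := norm_truncForce_sub_forceDeriv_le (a₀ := a₀) (a := a) (d := d) (η := 7 / 10 ^ 5)
    (by linarith) (by linarith) (by
      rw [add_sub_right_comm]; exact (norm_add_le _ _).trans (by linarith))
  refine h.trans ?_
  linarith [norm_nonneg d]

lemma norm_diff_sub_le {s t : BodyState} {R : ℝ} (h : ‖s - t‖ ≤ R) (i j : Fin 3) :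
    ‖(s.1 i - s.1 j) - (t.1 i - t.1 j)‖ ≤ 2 * R := by
  have h1 := norm_pos_le (s - t) i
  have h2 := norm_pos_le (s - t) j
  rw [sub_sub_sub_comm]
  refine (norm_sub_le _ _).trans ?_
  simp only [Prod.fst_sub, Pi.sub_apply] at h1 h2
  linarith

/-- Adding a variation to a state near the approximate orbit changes the field almost linearly, with
an error proportional to `‖c‖`. The velocity equations are exact because no velocity is truncated.
For the accelerations, X is the worst case: two variational residuals and two linearization errors.
-/
lemma linState_residual {s : BodyState} {t : ℝ} (ht : t ∈ Icc (0 : ℝ) 1) {c : Fin 4 → ℝ}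
    (hc : ‖c‖ ≤ 3 / 10 ^ 7) (hs : ‖s - approxState t‖ ≤ 3 / 10 ^ 5) :
    ‖truncField s + linStateDeriv c t - truncField (s + linState c t)‖ ≤ 9 / 10 ^ 3 * ‖c‖ := by
  have ht' := Icc_zero_subset ht
  have h1 := linComb_residual c ht'
  have h2 := linComb_residual c (neg_mem_Icc ht')
  rw [approxD_neg, linPairD_neg] at h2
  have hv (i : Fin 3) : ‖s.2 i‖ ≤ 98 / 100 := by
    have k1 := norm_vel_le (s - approxState t) i
    have k2 := norm_approxState_vel_le ht' i
    have k3 := norm_sub_norm_le (s.2 i) ((approxState t).2 i)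
    simp only [Prod.snd_sub, Pi.sub_apply] at k1
    linarith
  have hv' (i : Fin 3) : ‖(s + linState c t).2 i‖ ≤ 1 := by
    have k1 := norm_vel_le (linState c t) i
    have k2 := norm_linState_le c ht'
    rw [Prod.snd_add, Pi.add_apply]
    refine (norm_add_le _ _).trans ?_
    linarith [hv i]
  have pA := pair_error (approxA_large ht') (a := s.1 1 - s.1 2)
    (by rw [← approxState_diff_YX]; exact (norm_diff_sub_le hs 1 2).trans (by norm_num))
    (norm_linPairA_le c ht') hc
  have pB := pair_error (approxA_large (neg_mem_Icc ht')) (a := s.1 2 - s.1 0)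
    (by rw [← approxState_diff_XZ]; exact (norm_diff_sub_le hs 2 0).trans (by norm_num))
    (norm_linPairA_le c (neg_mem_Icc ht')) hc
  have pD := pair_error (approxD_large ht') (a := s.1 1 - s.1 0)
    (by rw [← approxState_diff_YZ]; exact (norm_diff_sub_le hs 1 0).trans (by norm_num))
    (norm_linPairD_le c ht') hc
  have dA : (s + linState c t).1 1 - (s + linState c t).1 2 = s.1 1 - s.1 2 + linPairA c t := by
    rw [← linState_diff_YX]; simp only [Prod.fst_add, Pi.add_apply]; ring
  have dB : (s + linState c t).1 2 - (s + linState c t).1 0 = s.1 2 - s.1 0 + linPairA c (-t) := by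
    rw [← linState_diff_XZ]; simp only [Prod.fst_add, Pi.add_apply]; ring
  have dD : (s + linState c t).1 1 - (s + linState c t).1 0 = s.1 1 - s.1 0 + linPairD c t := by
    rw [← linState_diff_YZ]; simp only [Prod.fst_add, Pi.add_apply]; ring
  have hc0 := norm_nonneg c
  refine norm_bodyState_le (fun i => ?_) (fun i => ?_)
  · rw [Prod.fst_sub, Pi.sub_apply, truncField_fst hv', Prod.fst_add, Pi.add_apply,
      truncField_fst fun i => (hv i).trans (by norm_num), Prod.snd_add, Pi.add_apply]
    have : (linStateDeriv c t).1 i = (3 : ℝ) • (linState c t).2 i := by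
      fin_cases i <;> simp [linStateDeriv, symStateDeriv, linState, symState]
    rw [this, smul_add, sub_self, norm_zero]
    positivity
  · rw [Prod.snd_sub, Pi.sub_apply, Prod.snd_add, Pi.add_apply]
    simp only [truncField, truncAcc_eq, dA, dB, dD]
    set eA := truncForce (s.1 1 - s.1 2 + linPairA c t) - truncForce (s.1 1 - s.1 2) -
      forceDeriv (approxA t) (linPairA c t) with heA
    set eB := truncForce (s.1 2 - s.1 0 + linPairA c (-t)) - truncForce (s.1 2 - s.1 0) -
      forceDeriv (approxA (-t)) (linPairA c (-t)) with heB
    set eD := truncForce (s.1 1 - s.1 0 + linPairD c t) - truncForce (s.1 1 - s.1 0) -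
      forceDeriv (approxD t) (linPairD c t) with heD
    fin_cases i
    · rw [show _ - _ = (3 : ℝ)⁻¹ • (-(linA c (-t) + forceDeriv (approxA (-t)) (linPairA c (-t)) +
        forceDeriv (approxD t) (linPairD c t)) - eB - eD) by
          simp [linStateDeriv, symStateDeriv, heB, heD]; ring]
      refine norm_third_smul_le ((norm_sub_le _ _).trans ?_)
      refine (add_le_add_left (norm_sub_le _ _) _).trans ?_
      rw [norm_neg]; linarith
    · rw [show _ - _ = (3 : ℝ)⁻¹ • ((linA c t + forceDeriv (approxA t) (linPairA c t) +
        forceDeriv (approxD t) (linPairD c t)) + eA + eD) by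
          simp [linStateDeriv, symStateDeriv, heA, heD]; ring]
      refine norm_third_smul_le (norm_add₃_le.trans ?_)
      linarith
    · rw [show _ - _ = (3 : ℝ)⁻¹ • (((linA c (-t) + forceDeriv (approxA (-t)) (linPairA c (-t)) +
        forceDeriv (approxD t) (linPairD c t)) - (linA c t + forceDeriv (approxA t) (linPairA c t) +
        forceDeriv (approxD t) (linPairD c t))) + (eB - eA)) by
          simp [linStateDeriv, symStateDeriv, heA, heB]; ring]
      refine norm_third_smul_le ((norm_add_le _ _).trans ?_)
      refine (add_le_add (norm_sub_le _ _) (norm_sub_le _ _)).trans ?_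
      linarith

end FigureEightData

/-! ### The shooting problem -/

/-- The quantities that vanish in a symmetric isosceles configuration. -/
noncomputable def isoscelesDefect (s : BodyState) : Fin 4 → ℝ :=
  ![(s.1 0).im, (s.1 2 - s.1 1).re, 3 * (s.2 0).re, 3 * (s.2 2 - s.2 1).im]

lemma isoscelesDefect_add (s t : BodyState) :
    isoscelesDefect (s + t) = isoscelesDefect s + isoscelesDefect t := by
  ext i; fin_cases i <;> simp [isoscelesDefect] <;> ring

lemma isoscelesDefect_sub (s t : BodyState) :
    isoscelesDefect (s - t) = isoscelesDefect s - isoscelesDefect t := by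
  ext i; fin_cases i <;> simp [isoscelesDefect] <;> ring

lemma norm_isoscelesDefect_le (s : BodyState) : ‖isoscelesDefect s‖ ≤ 6 * ‖s‖ := by
  refine (pi_norm_le_iff_of_nonneg (by positivity)).2 fun i => ?_
  have h0 := norm_nonneg s
  have h1 := norm_pos_le s
  have h2 := norm_vel_le s
  have re (z : ℂ) := Complex.abs_re_le_norm z
  have im (z : ℂ) := Complex.abs_im_le_norm z
  fin_cases i
  · show |(s.1 0).im| ≤ _
    linarith [im (s.1 0), h1 0]
  · show |(s.1 2 - s.1 1).re| ≤ _
    linarith [re (s.1 2 - s.1 1), norm_sub_le (s.1 2) (s.1 1), h1 1, h1 2]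
  · show |3 * (s.2 0).re| ≤ _
    rw [abs_mul, abs_of_pos (by norm_num : (0 : ℝ) < 3)]
    linarith [re (s.2 0), h2 0]
  · show |3 * (s.2 2 - s.2 1).im| ≤ _
    rw [abs_mul, abs_of_pos (by norm_num : (0 : ℝ) < 3)]
    linarith [im (s.2 2 - s.2 1), norm_sub_le (s.2 2) (s.2 1), h2 1, h2 2]

namespace FigureEightData
open IntPoly

lemma eval_one (l : List ℤ) : eval l 1 = evalInt l 1 := by
  simpa using eval_intCast l 1

lemma eval_neg_one (l : List ℤ) : eval l (-1) = evalInt l (-1) := by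
  simpa using eval_intCast l (-1)

lemma isoscelesDefect_symState_curve (c : ℝ) (l m : List ℤ) (i : Fin 4) :
    isoscelesDefect (symState (curve c l m) (curve c (der l) (der m)) 1) i =
      endCondition l m i / c := by
  fin_cases i
  · simp [isoscelesDefect, symState, endCondition, eval_one, eval_neg_one, neg_div]
  · simp [isoscelesDefect, symState, endCondition, eval_one, eval_neg_one]; ring
  · simp [isoscelesDefect, symState, endCondition, eval_one, eval_neg_one]
  · simp [isoscelesDefect, symState, endCondition, eval_one, eval_neg_one]; ring

lemma norm_isoscelesDefect_approxState : ‖isoscelesDefect (approxState 1)‖ ≤ 1 / 10 ^ 10 := by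
  refine (pi_norm_le_iff_of_nonneg (by positivity)).2 fun i => ?_
  have h := endCondition_le i
  have h' : |(endCondition yRe yIm i : ℝ)| ≤ 10 ^ 6 := by exact_mod_cast h
  rw [approxState, approxY, approxVel, isoscelesDefect_symState_curve, Real.norm_eq_abs, abs_div,
    abs_of_pos (by positivity : (0 : ℝ) < 10 ^ 16), div_le_iff₀ (by positivity)]
  exact h'.trans (by norm_num)

lemma linState_eq_sum (c : Fin 4 → ℝ) (t : ℝ) :
    linState c t = ∑ k, c k • symState (lin k) (linVel k) t := by
  refine Prod.ext (funext fun i => ?_) (funext fun i => ?_) <;> fin_cases i <;>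
    simp [linState, symState, linY, linV, Fin.sum_univ_four] <;> ring

lemma isoscelesDefect_smul (a : ℝ) (s : BodyState) :
    isoscelesDefect (a • s) = a • isoscelesDefect s := by
  ext i; fin_cases i <;> simp [isoscelesDefect] <;> ring

lemma norm_sub_isoscelesDefect_linState_le (c : Fin 4 → ℝ) :
    ‖c - isoscelesDefect (linState c 1)‖ ≤ 4 / 10 ^ 3 * ‖c‖ := by
  refine (pi_norm_le_iff_of_nonneg (by positivity)).2 fun i => ?_
  have e : (c - isoscelesDefect (linState c 1)) i =
      -∑ k, c k * (endCondition (linRe k) (linIm k) i / 10 ^ 9 - if i = k then 1 else 0) := by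
    have e1 : isoscelesDefect (linState c 1) i =
        ∑ k, c k * (endCondition (linRe k) (linIm k) i / 10 ^ 9) := by
      rw [linState_eq_sum]
      simp only [Fin.sum_univ_four, isoscelesDefect_add, isoscelesDefect_smul, Pi.add_apply,
        Pi.smul_apply, smul_eq_mul, lin, linVel, isoscelesDefect_symState_curve]
    rw [Pi.sub_apply, e1]
    simp [mul_sub, Finset.sum_sub_distrib]
  rw [e, norm_neg]
  refine (norm_sum_le_of_le (f := fun k => c k *
    ((endCondition (linRe k) (linIm k) i : ℝ) / 10 ^ 9 - if i = k then 1 else 0))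
    (n := fun _ => ‖c‖ * (1 / 10 ^ 3)) _ fun k _ => ?_).trans (le_of_eq ?_)
  · rw [norm_mul]
    refine mul_le_mul (norm_le_pi_norm c k) ?_ (norm_nonneg _) (norm_nonneg _)
    have h := endCondition_lin_le k i
    have h' : |(endCondition (linRe k) (linIm k) i : ℝ) - if i = k then 10 ^ 9 else 0| ≤ 10 ^ 6 := by
      exact_mod_cast h
    have e2 : (endCondition (linRe k) (linIm k) i : ℝ) / 10 ^ 9 - (if i = k then 1 else 0) =
        ((endCondition (linRe k) (linIm k) i : ℝ) - if i = k then 10 ^ 9 else 0) / 10 ^ 9 := by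
      split_ifs <;> ring
    rw [e2, Real.norm_eq_abs, abs_div, abs_of_pos (by positivity : (0 : ℝ) < 10 ^ 9),
      div_le_iff₀ (by positivity)]
    exact h'.trans (by norm_num)
  · simp; ring

lemma norm_sub_approxState_le {x : ℝ → BodyState} (hx : IsTruncSolution x) {c : Fin 4 → ℝ}
    (h0 : x 0 = approxState 0 + linState c 0) {t : ℝ} (ht : t ∈ Icc (0 : ℝ) 1) :
    ‖x t - approxState t‖ ≤ 242 * ‖c‖ + 9 / 10 ^ 9 := by
  refine (norm_sub_le_of_residual hx (δ := 12 * ‖c‖)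
    (fun t _ => hasDerivAt_symState hasDerivAt_approxY hasDerivAt_approxVel t)
    (fun t ht => approxState_residual ht) ?_ ht).trans ?_
  · rw [h0]
    have := norm_linState_le c (t := 0) (by simp)
    simpa [approxState] using this
  · linarith [norm_nonneg c]

/-- The solution `x` is compared with `x'` plus a variation, not with the approximate orbit. Both
start at the same state, so the error is proportional to `‖c - c'‖`, without the constant residual
of the orbit. -/
lemma norm_sub_sub_linState_le {x x' : ℝ → BodyState} (hx : IsTruncSolution x)
    (hx' : IsTruncSolution x') {c c' : Fin 4 → ℝ} (h0 : x 0 = approxState 0 + linState c 0)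
    (h0' : x' 0 = approxState 0 + linState c' 0) (hc : ‖c‖ ≤ 12 / 10 ^ 8)
    (hc' : ‖c'‖ ≤ 12 / 10 ^ 8) {t : ℝ} (ht : t ∈ Icc (0 : ℝ) 1) :
    ‖x t - (x' t + linState (c - c') t)‖ ≤ 6 / 10 ^ 2 * ‖c - c'‖ := by
  refine (norm_sub_le_of_residual hx (δ := 0) (ε := 9 / 10 ^ 3 * ‖c - c'‖)
    (z := fun t => x' t + linState (c - c') t)
    (fun t _ => (hx' t).add (hasDerivAt_symState (hasDerivAt_linY _) (hasDerivAt_linV _) t))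
    (fun t ht => linState_residual ht ((norm_sub_le _ _).trans (by linarith))
      ((norm_sub_approxState_le hx' h0' ht).trans (by linarith))) ?_ ht).trans ?_
  · have e : linState c 0 = linState c' 0 + linState (c - c') 0 := by
      simp only [linState_eq_sum, ← Finset.sum_add_distrib, ← add_smul, Pi.sub_apply,
        add_sub_cancel]
    rw [h0, h0', e, add_assoc, sub_self, norm_zero]
  · linarith [norm_nonneg (c - c')]

/-- There is a solution of the truncated equations, close to the approximate one, from a collinear
configuration at time `0` to a symmetric isosceles one at time `1`. -/
theorem exists_truncSolution_isosceles : ∃ (x : ℝ → BodyState) (c : Fin 4 → ℝ),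
    IsTruncSolution x ∧ x 0 = approxState 0 + linState c 0 ∧ isoscelesDefect (x 1) = 0 ∧
      ∀ t ∈ Icc (0 : ℝ) 1, ‖x t - approxState t‖ ≤ 3 / 10 ^ 5 := by
  choose x h0 hx using fun c : Fin 4 → ℝ => exists_truncSolution (approxState 0 + linState c 0)
  -- A simplified Newton step, with the identity as approximate inverse derivative; its fixed points
  -- are the zeros of the defect.
  set N : (Fin 4 → ℝ) → Fin 4 → ℝ := fun c => c - isoscelesDefect (x c 1) with hN
  set B : Set (Fin 4 → ℝ) := Metric.closedBall 0 (12 / 10 ^ 8) with hB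
  have hmem (c : Fin 4 → ℝ) : c ∈ B ↔ ‖c‖ ≤ 12 / 10 ^ 8 := by simp [hB]
  have h1 : (1 : ℝ) ∈ Icc (0 : ℝ) 1 := by simp
  have hcontr : ∀ c ∈ B, ∀ c' ∈ B, ‖N c - N c'‖ ≤ 1 / 2 * ‖c - c'‖ := by
    intro c hc c' hc'
    have e : N c - N c' = (c - c' - isoscelesDefect (linState (c - c') 1)) -
        isoscelesDefect (x c 1 - (x c' 1 + linState (c - c') 1)) := by
      simp only [hN, isoscelesDefect_sub, isoscelesDefect_add]; abel
    have k1 := norm_sub_sub_linState_le (hx c) (hx c') (h0 c) (h0 c') ((hmem c).1 hc)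
      ((hmem c').1 hc') h1
    have k2 := norm_isoscelesDefect_le (x c 1 - (x c' 1 + linState (c - c') 1))
    have k3 := norm_sub_isoscelesDefect_linState_le (c - c')
    rw [e]
    refine (norm_sub_le _ _).trans ?_
    -- The factor is `4 / 10 ^ 3 + 6 * (6 / 10 ^ 2) < 1 / 2`, where 6 is the norm bound of
    -- `isoscelesDefect`.
    linarith [norm_nonneg (c - c')]
  have hzero : ‖N 0‖ ≤ 6 / 10 ^ 8 := by
    have k1 := norm_sub_approxState_le (hx 0) (h0 0) h1
    rw [norm_zero] at k1
    have k2 := norm_isoscelesDefect_le (x 0 1 - approxState 1)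
    have k3 := norm_isoscelesDefect_approxState
    rw [isoscelesDefect_sub] at k2
    have k4 := norm_sub_norm_le (isoscelesDefect (x 0 1)) (isoscelesDefect (approxState 1))
    simp only [hN, zero_sub, norm_neg]
    linarith
  -- The radius of the ball is twice the bound on `‖N 0‖`, as a contraction factor `1 / 2` requires.
  have hmaps : MapsTo N B B := by
    intro c hc
    have k := hcontr c hc 0 ((hmem 0).2 (by rw [norm_zero]; positivity))
    rw [hmem] at hc ⊢
    rw [sub_zero] at k
    linarith [norm_sub_norm_le (N c) (N 0)]
  have hK : ContractingWith (1 / 2) (hmaps.restrict N B B) := by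
    refine ⟨by rw [← NNReal.coe_lt_coe]; norm_num, LipschitzWith.of_dist_le_mul fun a b => ?_⟩
    simpa [Subtype.dist_eq, dist_eq_norm] using hcontr a a.2 b b.2
  obtain ⟨c, hcB, hfix, -⟩ := hK.exists_fixedPoint' Metric.isClosed_closedBall.isComplete hmaps
    ((hmem 0).2 (by rw [norm_zero]; positivity)) (edist_ne_top _ _)
  refine ⟨x c, c, hx c, h0 c, ?_, fun t ht => ?_⟩
  · have : c - isoscelesDefect (x c 1) = c := hfix
    simpa using this
  · have := (hmem c).1 hcB
    refine (norm_sub_approxState_le (hx c) (h0 c) ht).trans (by linarith)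

end FigureEightData

/-! ### Conserved quantities -/

lemma truncAcc_sum (q : Fin 3 → ℂ) : ∑ i, truncAcc q i = 0 := by
  rw [truncAcc_eq, Fin.sum_univ_three]
  simp
  ring

/-- A third of the angular momentum per unit mass. -/
noncomputable def stateMomentum (s : BodyState) : ℝ :=
  ∑ i, ((starRingEnd ℂ) (s.1 i) * s.2 i).im

lemma sum_conj_mul_truncAcc (q : Fin 3 → ℂ) :
    ∑ i, ((starRingEnd ℂ) (q i) * truncAcc q i).im = 0 := by
  have h (z : ℂ) : ∃ a : ℝ, truncForce z = a • z := ⟨_, rfl⟩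
  obtain ⟨a, ha⟩ := h (q 1 - q 0)
  obtain ⟨b, hb⟩ := h (q 2 - q 0)
  obtain ⟨c, hc⟩ := h (q 1 - q 2)
  rw [truncAcc_eq, Fin.sum_univ_three, ha, hb, hc]
  simp
  ring

namespace IsTruncSolution
variable {x : ℝ → BodyState} (hx : IsTruncSolution x)
include hx

lemma sum_vel_eq (t : ℝ) : ∑ i, (x t).2 i = ∑ i, (x 0).2 i := by
  have hd (t : ℝ) : HasDerivAt (fun t => ∑ i, (x t).2 i) 0 t := by
    refine (HasDerivAt.fun_sum fun i _ => hx.hasDerivAt_snd i t).congr_deriv ?_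
    rw [← Finset.smul_sum, truncAcc_sum, smul_zero]
  exact is_const_of_deriv_eq_zero (fun t => (hd t).differentiableAt) (fun t => (hd t).deriv) t 0

/-- Truncation preserves directions: truncated velocities are parallel to the velocities, and the
forces stay central and pairwise opposite. -/
lemma stateMomentum_eq (t : ℝ) : stateMomentum (x t) = stateMomentum (x 0) := by
  have hd (t : ℝ) : HasDerivAt (fun t => stateMomentum (x t)) 0 t := by
    have h1 (i : Fin 3) : HasDerivAt (fun t => ((starRingEnd ℂ) ((x t).1 i) * (x t).2 i).im)
        ((starRingEnd ℂ) ((3 : ℝ) • truncVel ((x t).2 i)) * (x t).2 i +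
          (starRingEnd ℂ) ((x t).1 i) * ((3 : ℝ)⁻¹ • truncAcc (x t).1 i)).im t := by
      have hc : HasDerivAt (fun t => (starRingEnd ℂ) ((x t).1 i))
          ((starRingEnd ℂ) ((3 : ℝ) • truncVel ((x t).2 i))) t := by
        have := (Complex.conjCLE.toContinuousLinearMap.hasFDerivAt
          (x := (x t).1 i)).comp_hasDerivAt t (hx.hasDerivAt_fst i t)
        exact this
      exact (Complex.imCLM.hasFDerivAt).comp_hasDerivAt t (hc.mul (hx.hasDerivAt_snd i t))
    refine (HasDerivAt.fun_sum fun i _ => h1 i).congr_deriv ?_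
    have h2 (i : Fin 3) : ((starRingEnd ℂ) ((3 : ℝ) • truncVel ((x t).2 i)) * (x t).2 i +
        (starRingEnd ℂ) ((x t).1 i) * ((3 : ℝ)⁻¹ • truncAcc (x t).1 i)).im =
        3⁻¹ * ((starRingEnd ℂ) ((x t).1 i) * truncAcc (x t).1 i).im := by
      simp [truncVel]
      ring
    rw [Finset.sum_congr rfl fun i _ => h2 i, ← Finset.mul_sum, sum_conj_mul_truncAcc, mul_zero]
  exact is_const_of_deriv_eq_zero (fun t => (hd t).differentiableAt) (fun t => (hd t).deriv) t 0

end IsTruncSolution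

/-! ### The symmetric solution -/

/-- Neither the attraction nor the velocities are affected by the truncation. -/
def IsUntruncated (s : BodyState) : Prop :=
  (∀ i, ‖s.2 i‖ ≤ 1) ∧ ∀ i j, i ≠ j → 49 / 50 ≤ ‖s.1 i - s.1 j‖

lemma IsUntruncated.map {s : BodyState} (hs : IsUntruncated s) (A : ℂ ≃ₗᵢ[ℝ] ℂ)
    (σ : Equiv.Perm (Fin 3)) : IsUntruncated (fun i => A (s.1 (σ i)), fun i => -A (s.2 (σ i))) := by
  refine ⟨fun i => ?_, fun i j hij => ?_⟩
  · simp only [norm_neg, LinearIsometryEquiv.norm_map]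
    exact hs.1 _
  · simp only [← map_sub, LinearIsometryEquiv.norm_map]
    exact hs.2 _ _ (σ.injective.ne hij)

/-- Periodic solutions of the three-body equations that have the symmetries of the figure-eight
solution, and run through the first twelfth of their period like it. -/
structure IsEightSolution (x : ℝ → BodyState) : Prop where
  solution : IsTruncSolution x
  untruncated : ∀ t, IsUntruncated (x t)
  momentum : ∀ t, stateMomentum (x t) = 0
  reverse_zero : reverseWith (LinearIsometryEquiv.neg ℝ) (Equiv.swap 0 1) 0 x = x
  reverse_one : reverseWith Complex.conjLIE (Equiv.swap 1 2) 2 x = x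
  velX_re_pos : ∀ t ∈ Icc (0 : ℝ) 1, 0 < ((x t).2 2).re
  velX_im_pos : ∀ t ∈ Icc (0 : ℝ) 1, 0 < ((x t).2 2).im
  velY_re_neg : ∀ t ∈ Icc (0 : ℝ) 1, ((x t).2 1).re < 0
  posY_im_neg : ∀ t ∈ Icc (0 : ℝ) 1, ((x t).1 1).im < 0
  velZ_im_neg : ∀ t ∈ Icc (0 : ℝ) 1, ((x t).2 0).im < 0
  accZ_re_pos : ∀ t ∈ Icc (0 : ℝ) 1, 0 < ((truncField (x t)).2 0).re

namespace FigureEightData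
open IntPoly

variable {x : ℝ → BodyState} {c : Fin 4 → ℝ}

lemma symState_zero_symm (y v : ℝ → ℂ) (i : Fin 3) :
    (symState y v 0).1 i = -(symState y v 0).1 (Equiv.swap 0 1 i) ∧
      (symState y v 0).2 i = (symState y v 0).2 (Equiv.swap 0 1 i) := by
  fin_cases i
  · simp [symState]
  · simp [symState]
  · simp [symState, Equiv.swap_apply_of_ne_of_ne]

/-- All initial data of the form `symState` at time 0 are invariant under this reversal, so
uniqueness gives the symmetry for every `c`. -/
lemma reverse_zero_eq (hx : IsTruncSolution x) (h0 : x 0 = approxState 0 + linState c 0) :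
    reverseWith (LinearIsometryEquiv.neg ℝ) (Equiv.swap 0 1) 0 x = x := by
  refine (hx.reverseWith _ _ _).ext hx (t₀ := 0) (Prod.ext (funext fun i => ?_) (funext fun i => ?_))
  · have h1 := (symState_zero_symm approxY approxVel i).1
    have h2 := (symState_zero_symm (linY c) (linV c) i).1
    simp only [reverseWith, sub_zero, h0, LinearIsometryEquiv.coe_neg, Prod.fst_add, Pi.add_apply,
      approxState, linState]
    rw [h1, h2, neg_add]
  · have h1 := (symState_zero_symm approxY approxVel i).2
    have h2 := (symState_zero_symm (linY c) (linV c) i).2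
    simp only [reverseWith, sub_zero, h0, LinearIsometryEquiv.coe_neg, Prod.snd_add, Pi.add_apply,
      approxState, linState]
    rw [h1, h2, neg_neg]

lemma symState_zero_sums (y v : ℝ → ℂ) : ∑ i, (symState y v 0).1 i = 0 ∧
    ∑ i, (symState y v 0).2 i = 0 := by
  constructor
  · simp [symState, Fin.sum_univ_three]
  · simp [symState, Fin.sum_univ_three, smul_add]

lemma initial_sums (h0 : x 0 = approxState 0 + linState c 0) :
    ∑ i, (x 0).1 i = 0 ∧ ∑ i, (x 0).2 i = 0 := by
  have h1 := symState_zero_sums approxY approxVel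
  have h2 := symState_zero_sums (linY c) (linV c)
  simp only [h0, Prod.fst_add, Prod.snd_add, Pi.add_apply, Finset.sum_add_distrib, approxState,
    linState, h1, h2, add_zero, and_self]

lemma isUntruncated_of_near {s : BodyState} {t : ℝ} (ht : t ∈ Icc (0 : ℝ) 1)
    (h : ‖s - approxState t‖ ≤ 3 / 10 ^ 5) : IsUntruncated s := by
  have ht' := Icc_zero_subset ht
  refine ⟨fun i => ?_, ?_⟩
  · have k1 := (norm_vel_le (s - approxState t) i).trans h
    have k2 := norm_approxState_vel_le ht' i
    have k3 := norm_sub_norm_le (s.2 i) ((approxState t).2 i)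
    simp only [Prod.snd_sub, Pi.sub_apply] at k1
    linarith
  · have key (i j : Fin 3) (hij : 99 / 100 ≤ ‖(approxState t).1 i - (approxState t).1 j‖) :
        49 / 50 ≤ ‖s.1 i - s.1 j‖ := by
      have k1 := norm_diff_sub_le h i j
      have k2 := norm_sub_norm_le ((approxState t).1 i - (approxState t).1 j) (s.1 i - s.1 j)
      rw [norm_sub_rev] at k1
      linarith
    have h12 := key 1 2 (by rw [approxState_diff_YX]; exact approxA_large ht')
    have h20 := key 2 0 (by rw [approxState_diff_XZ]; exact approxA_large (neg_mem_Icc ht'))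
    have h10 := key 1 0 (by rw [approxState_diff_YZ]; exact approxD_large ht')
    intro i j hij
    fin_cases i <;> fin_cases j <;> first | exact absurd rfl hij | assumption | skip
    · rw [norm_sub_rev]; exact h10
    · rw [norm_sub_rev]; exact h20
    · rw [norm_sub_rev]; exact h12

/-- The sum of the velocities is always conserved, but the truncated velocities need not sum to
zero. The argument is therefore confined to `[0, 1]`, where the truncation is known to be inactive.
-/
lemma sum_pos_eq_zero (hx : IsTruncSolution x) (h0 : x 0 = approxState 0 + linState c 0)
    (h : ∀ t ∈ Icc (0 : ℝ) 1, ‖x t - approxState t‖ ≤ 3 / 10 ^ 5) : ∑ i, (x 1).1 i = 0 := by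
  have hd (t : ℝ) (ht : t ∈ Icc (0 : ℝ) 1) : HasDerivAt (fun t => ∑ i, (x t).1 i) 0 t := by
    refine (HasDerivAt.fun_sum fun i _ => hx.hasDerivAt_fst i t).congr_deriv ?_
    simp only [truncVel_of_le ((isUntruncated_of_near ht (h t ht)).1 _)]
    rw [← Finset.smul_sum, hx.sum_vel_eq, (initial_sums h0).2, smul_zero]
  have := constant_of_has_deriv_right_zero
    (fun t ht => (hd t ht).continuousAt.continuousWithinAt)
    (fun t ht => (hd t (Ico_subset_Icc_self ht)).hasDerivWithinAt) 1 (by simp)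
  rw [this, (initial_sums h0).1]

/-- The four defects are half of the relations for a symmetric state at time 1; the others follow
from the centre of mass being at rest at the origin. Uniqueness then propagates the symmetry. -/
lemma reverse_one_eq (hx : IsTruncSolution x) (h0 : x 0 = approxState 0 + linState c 0)
    (h : ∀ t ∈ Icc (0 : ℝ) 1, ‖x t - approxState t‖ ≤ 3 / 10 ^ 5)
    (h1 : isoscelesDefect (x 1) = 0) :
    reverseWith Complex.conjLIE (Equiv.swap 1 2) 2 x = x := by
  have d0 : ((x 1).1 0).im = 0 := congrFun h1 0
  have d1 : ((x 1).1 2 - (x 1).1 1).re = 0 := congrFun h1 1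
  have d2 : 3 * ((x 1).2 0).re = 0 := congrFun h1 2
  have d3 : 3 * ((x 1).2 2 - (x 1).2 1).im = 0 := congrFun h1 3
  have s1 := sum_pos_eq_zero hx h0 h
  have s2 := hx.sum_vel_eq 1
  rw [(initial_sums h0).2] at s2
  rw [Fin.sum_univ_three] at s1 s2
  have s1' := congrArg Complex.im s1
  have s2' := congrArg Complex.re s2
  simp only [Complex.add_im, Complex.add_re, Complex.zero_im, Complex.zero_re, Complex.sub_re,
    Complex.sub_im] at s1' s2' d1 d3
  refine (hx.reverseWith _ _ _).ext hx (t₀ := 1) (Prod.ext (funext fun i => ?_) (funext fun i => ?_))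
  all_goals
    simp only [reverseWith, show (2 : ℝ) - 1 = 1 by norm_num, Complex.conjLIE_apply]
    fin_cases i <;> apply Complex.ext <;>
      simp [Equiv.swap_apply_of_ne_of_ne, Equiv.swap_apply_left, Equiv.swap_apply_right] <;> linarith

end FigureEightData

/-! ### The shape of a curve with the symmetries of the figure eight -/

/-- A closed curve with the symmetries of the figure eight, that moves to the right in the upper
half-plane during the first quarter of its period `12`. -/
structure IsSymmetricEight (s v : ℝ → ℂ) : Prop where
  hasDerivAt : ∀ t, HasDerivAt s (v t) t
  continuous_vel : Continuous v
  odd : ∀ t, s (-t) = -s t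
  reflect : ∀ t, s (6 - t) = (starRingEnd ℂ) (s t)
  vel_re_pos : ∀ t ∈ Ico (0 : ℝ) 3, 0 < (v t).re
  im_pos : ∀ t ∈ Ioo (0 : ℝ) 3, 0 < (s t).im
  vel_three : v 3 ≠ 0
  vel_zero_im : (v 0).im ≠ 0

namespace IsSymmetricEight
variable {s v : ℝ → ℂ} (h : IsSymmetricEight s v)
include h

lemma map_add_six (t : ℝ) : s (t + 6) = -(starRingEnd ℂ) (s t) := by
  rw [show t + 6 = 6 - -t by ring, h.reflect, h.odd, map_neg]

lemma periodic : Function.Periodic s 12 := fun t => by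
  rw [show t + 12 = t + 6 + 6 by ring, h.map_add_six, h.map_add_six]
  simp

lemma vel_reflect (t : ℝ) : v (6 - t) = -(starRingEnd ℂ) (v t) := by
  have h1 : HasDerivAt (fun u => s (6 - u)) (-v (6 - t)) t := by
    simpa [Function.comp_def] using
      (h.hasDerivAt (6 - t)).scomp t ((hasDerivAt_id t).const_sub 6)
  have h2 : HasDerivAt (fun u => (starRingEnd ℂ) (s u)) ((starRingEnd ℂ) (v t)) t := by
    have := (Complex.conjCLE.toContinuousLinearMap.hasFDerivAt (x := s t)).comp_hasDerivAt t
      (h.hasDerivAt t)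
    exact this
  have h3 := h1.unique (h2.congr_of_eventuallyEq (Filter.Eventually.of_forall h.reflect))
  rw [← h3, neg_neg]

lemma vel_even (t : ℝ) : v (-t) = v t := by
  have h1 : HasDerivAt (fun u => s (-u)) (-v (-t)) t := by
    simpa [Function.comp_def] using (h.hasDerivAt (-t)).scomp t (hasDerivAt_neg t)
  have h3 := h1.unique ((h.hasDerivAt t).neg.congr_of_eventuallyEq
    (Filter.Eventually.of_forall h.odd))
  exact neg_injective h3

lemma vel_add_six (t : ℝ) : v (t + 6) = -(starRingEnd ℂ) (v t) := by
  rw [show t + 6 = 6 - -t by ring, h.vel_reflect, h.vel_even]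

lemma vel_ne_zero (t : ℝ) : v t ≠ 0 := by
  have hper : Function.Periodic (fun t => v t ≠ 0) 6 := fun t => by
    simp [h.vel_add_six]
  have h3 : ∀ u ∈ Icc (0 : ℝ) 3, v u ≠ 0 := by
    intro u hu h0
    rcases hu.2.eq_or_lt with rfl | hlt
    · exact h.vel_three h0
    · have := h.vel_re_pos u ⟨hu.1, hlt⟩
      rw [h0] at this
      simp at this
  obtain ⟨u, hu, e⟩ := hper.exists_mem_Ico₀ (by norm_num) t
  rw [e]
  rcases le_total u 3 with h1 | h1
  · exact h3 u ⟨hu.1, h1⟩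
  · have := h3 (6 - u) ⟨by linarith [hu.2], by linarith⟩
    rw [h.vel_reflect] at this
    simpa using this

lemma map_zero : s 0 = 0 := by
  have := h.odd 0
  rw [neg_zero] at this
  exact self_eq_neg.1 this

lemma map_six : s 6 = 0 := by
  have := h.reflect 0
  rwa [sub_zero, h.map_zero, _root_.map_zero] at this

lemma re_strictMonoOn : StrictMonoOn (fun t => (s t).re) (Icc 0 3) := by
  have hd (t : ℝ) : HasDerivAt (fun t => (s t).re) (v t).re t :=
    (Complex.reCLM.hasFDerivAt (x := s t)).comp_hasDerivAt t (h.hasDerivAt t)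
  refine strictMonoOn_of_deriv_pos (convex_Icc 0 3)
    (fun t _ => (hd t).continuousAt.continuousWithinAt) fun t ht => ?_
  rw [interior_Icc] at ht
  rw [(hd t).deriv]
  exact h.vel_re_pos t (Ioo_subset_Ico_self ht)

lemma re_reflect (t : ℝ) : (s (6 - t)).re = (s t).re := by rw [h.reflect, Complex.conj_re]

lemma im_reflect (t : ℝ) : (s (6 - t)).im = -(s t).im := by rw [h.reflect, Complex.conj_im]

lemma re_pos {t : ℝ} (ht : t ∈ Ioo (0 : ℝ) 6) : 0 < (s t).re := by
  have key : ∀ u ∈ Ioc (0 : ℝ) 3, 0 < (s u).re := fun u hu => by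
    have := h.re_strictMonoOn (a := 0) (b := u) ⟨le_rfl, by norm_num⟩ ⟨hu.1.le, hu.2⟩ hu.1
    simpa [h.map_zero] using this
  rcases le_total t 3 with h1 | h1
  · exact key t ⟨ht.1, h1⟩
  · rw [← h.re_reflect]
    exact key _ ⟨by linarith [ht.2], by linarith⟩

lemma re_neg {t : ℝ} (ht : t ∈ Ioo (6 : ℝ) 12) : (s t).re < 0 := by
  have := h.re_pos (t := t - 6) ⟨by linarith [ht.1], by linarith [ht.2]⟩
  rw [show t = t - 6 + 6 by ring, h.map_add_six]
  simpa using this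

lemma re_nonneg {t : ℝ} (ht : t ∈ Icc (0 : ℝ) 6) : 0 ≤ (s t).re := by
  rcases ht.1.eq_or_lt with rfl | h1
  · rw [h.map_zero]; simp
  rcases ht.2.eq_or_lt with rfl | h2
  · rw [h.map_six]; simp
  exact (h.re_pos ⟨h1, h2⟩).le

lemma re_nonpos {t : ℝ} (ht : t ∈ Icc (6 : ℝ) 12) : (s t).re ≤ 0 := by
  have := h.re_nonneg (t := t - 6) ⟨by linarith [ht.1], by linarith [ht.2]⟩
  rw [show t = t - 6 + 6 by ring, h.map_add_six]
  simpa using this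

/-- The real part is injective on each half of the lobe. Points on different halves with equal real
parts are mirror images, separated by the sign of the imaginary part. -/
lemma injOn_lobe : InjOn s (Ioo 0 6) := by
  have key : ∀ t ∈ Ioo (0 : ℝ) 6, ∀ u ∈ Ioo (0 : ℝ) 6, t < u → s t ≠ s u := by
    intro t ht u hu htu e
    have ere : (s t).re = (s u).re := by rw [e]
    have eim : (s t).im = (s u).im := by rw [e]
    have inj := h.re_strictMonoOn.injOn
    rcases le_total u 3 with h1 | h1
    · exact htu.ne (inj ⟨ht.1.le, htu.le.trans h1⟩ ⟨hu.1.le, h1⟩ ere)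
    rcases le_total t 3 with h2 | h2
    · have e1 : t = 6 - u := inj ⟨ht.1.le, h2⟩ ⟨by linarith [hu.2], by linarith⟩
        (by simpa only [h.re_reflect] using ere)
      have h3 : t < 3 := by linarith
      have h4 := h.im_pos t ⟨ht.1, h3⟩
      have h5 := h.im_reflect t
      rw [show 6 - t = u by linarith] at h5
      linarith
    · have e1 : 6 - t = 6 - u := inj ⟨by linarith [ht.2], by linarith⟩
        ⟨by linarith [hu.2], by linarith⟩ (by simpa only [h.re_reflect] using ere)
      linarith
  intro t ht u hu e
  by_contra hne
  rcases lt_or_gt_of_ne hne with h1 | h1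
  · exact key t ht u hu h1 e
  · exact key u hu t ht h1 e.symm

lemma double_point {t u : ℝ} (ht : t ∈ Ico (0 : ℝ) 12) (hu : u ∈ Ico (0 : ℝ) 12) (htu : t < u)
    (e : s t = s u) : t = 0 ∧ u = 6 := by
  have ere : (s t).re = (s u).re := by rw [e]
  rcases ht.1.eq_or_lt with h0 | h0
  · refine ⟨h0.symm, ?_⟩
    rw [← h0, h.map_zero, Complex.zero_re] at ere
    rcases lt_trichotomy u 6 with h1 | h1 | h1
    · exact absurd ere (h.re_pos ⟨by linarith, h1⟩).ne
    · exact h1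
    · exact absurd ere (h.re_neg ⟨h1, hu.2⟩).ne'
  · exfalso
    rcases lt_trichotomy t 6 with h1 | h1 | h1
    · have hp := h.re_pos ⟨h0, h1⟩
      rcases lt_or_ge u 6 with h2 | h2
      · exact htu.ne (h.injOn_lobe ⟨h0, h1⟩ ⟨by linarith, h2⟩ e)
      · linarith [h.re_nonpos ⟨h2, hu.2.le⟩]
    · rw [h1, h.map_six, Complex.zero_re] at ere
      exact (h.re_neg ⟨by linarith, hu.2⟩).ne' ere
    · have e2 : s (t - 6) = s (u - 6) := by
        have e3 := h.map_add_six (t - 6)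
        have e4 := h.map_add_six (u - 6)
        rw [sub_add_cancel] at e3 e4
        rw [e3, e4] at e
        exact (starRingEnd ℂ).injective (neg_injective e)
      have := h.injOn_lobe (x₁ := t - 6) ⟨by linarith, by linarith [ht.2]⟩ (x₂ := u - 6)
        ⟨by linarith, by linarith [hu.2]⟩ e2
      linarith

omit h in
-- An open half-plane that misses `K` is connected and unbounded, so it lies in an unbounded
-- component. The sign of `c` selects the side.
lemma not_isBounded_component {K : Set ℂ} {z : ℂ} {c : ℝ} (hc : c ≠ 0)
    (hK : ∀ w ∈ K, c * w.re ≤ 0) (hz : 0 < c * z.re) :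
    ¬ Bornology.IsBounded (connectedComponentIn Kᶜ z) := by
  intro hb
  have hconv : Convex ℝ {w : ℂ | 0 < c * w.re} := by
    have : IsLinearMap ℝ fun w : ℂ => c * w.re :=
      ⟨fun x y => by simp [mul_add], fun a x => by simp; ring⟩
    exact convex_halfSpace_gt this 0
  have hsub : {w : ℂ | 0 < c * w.re} ⊆ connectedComponentIn Kᶜ z :=
    hconv.isPreconnected.subset_connectedComponentIn hz
      fun w hw hwK => (hK w hwK).not_gt hw
  obtain ⟨R, hR⟩ := (hb.subset hsub).exists_norm_le
  -- One of the two test points `(|R| + 1) / c` and `(|R| + 1) * c` has norm above `R`, according to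
  -- whether `|c| ≤ 1` or `|c| ≥ 1`.
  have h1 := hR (((|R| + 1) / c : ℝ) : ℂ) (by
    simp only [mem_ofPred_eq, Complex.ofReal_re]
    rw [mul_div_cancel₀ _ hc]
    positivity)
  have h2 := hR (((|R| + 1) * c : ℝ) : ℂ) (by
    simp only [mem_ofPred_eq, Complex.ofReal_re]
    have : 0 < c * c := mul_self_pos.2 hc
    nlinarith [abs_nonneg R])
  rw [Complex.norm_real, Real.norm_eq_abs, abs_div, abs_of_pos (by positivity : 0 < |R| + 1),
    div_le_iff₀ (abs_pos.2 hc)] at h1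
  rw [Complex.norm_real, Real.norm_eq_abs, abs_mul, abs_of_pos (by positivity : 0 < |R| + 1)] at h2
  have h3 := le_abs_self R
  have h4 := abs_pos.2 hc
  rcases le_total 1 |c| with h5 | h5
  · nlinarith [abs_nonneg R]
  · nlinarith [abs_nonneg R]

theorem isFigureEight : IsFigureEight 12 s where
  periodic := h.periodic
  contDiff := by
    rw [contDiff_one_iff_deriv]
    refine ⟨fun t => (h.hasDerivAt t).differentiableAt, ?_⟩
    rw [show deriv s = v from funext fun t => (h.hasDerivAt t).deriv]
    exact h.continuous_vel
  immersed t := by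
    rw [(h.hasDerivAt t).deriv]
    exact h.vel_ne_zero t
  crossing := by
    refine ⟨0, 6, by norm_num, by norm_num, by rw [h.map_zero, h.map_six], ?_, ?_, ?_, ?_⟩
    · intro t ht u hu htu e
      rw [zero_add] at ht hu
      exact h.double_point ht hu htu e
    -- The velocities at the crossing are `v 0` and `-conj (v 0)`, which are independent because
    -- both coordinates of `v 0` are nonzero.
    · rw [(h.hasDerivAt 0).deriv, (h.hasDerivAt 6).deriv, LinearIndependent.pair_iff]
      intro a b e
      have h6 := h.vel_add_six 0
      rw [zero_add] at h6
      have h0 := (h.vel_re_pos 0 (by norm_num)).ne'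
      rw [h6] at e
      have e1 := congrArg Complex.re e
      have e2 := congrArg Complex.im e
      simp only [Complex.add_re, Complex.smul_re, Complex.neg_re, Complex.conj_re, smul_eq_mul,
        Complex.zero_re, Complex.add_im, Complex.smul_im, Complex.neg_im, Complex.conj_im, neg_neg,
        Complex.zero_im] at e1 e2
      have e3 : a - b = 0 := (mul_eq_zero.1 (by linarith : (a - b) * (v 0).re = 0)).resolve_right h0
      have e4 : a + b = 0 :=
        (mul_eq_zero.1 (by linarith : (a + b) * (v 0).im = 0)).resolve_right h.vel_zero_im
      constructor <;> linarith
    · rintro _ ⟨t, ht, rfl⟩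
      refine not_isBounded_component one_ne_zero ?_ ?_
      · rintro _ ⟨u, hu, rfl⟩
        rw [zero_add] at hu
        rw [one_mul]
        exact h.re_nonpos hu
      · rw [one_mul]
        exact h.re_pos ht
    · rintro _ ⟨t, ht, rfl⟩
      rw [zero_add] at ht
      refine not_isBounded_component (c := -1) (by norm_num) ?_ ?_
      · rintro _ ⟨u, hu, rfl⟩
        linarith [h.re_nonneg hu]
      · linarith [h.re_neg ht]

end IsSymmetricEight

lemma IsUntruncated.of_reverse {x : ℝ → BodyState} {A : ℂ ≃ₗᵢ[ℝ] ℂ} {σ : Equiv.Perm (Fin 3)}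
    {c t : ℝ} (h : reverseWith A σ c x = x) (hs : IsUntruncated (x (c - t))) :
    IsUntruncated (x t) := by
  rw [← congrFun h t]
  exact hs.map A σ

/-- The reversals about 0 and 1 compose to a shift by 2, so every time reduces to `[0, 1]`. -/
lemma isUntruncated_of_symmetric {x : ℝ → BodyState} {A B : ℂ ≃ₗᵢ[ℝ] ℂ}
    {σ τ : Equiv.Perm (Fin 3)} (h0 : reverseWith A σ 0 x = x) (h1 : reverseWith B τ 2 x = x)
    (h : ∀ t ∈ Icc (0 : ℝ) 1, IsUntruncated (x t)) (t : ℝ) : IsUntruncated (x t) := by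
  have hper : Function.Periodic (fun t => IsUntruncated (x t)) 2 := fun t => by
    refine propext ⟨fun ht => IsUntruncated.of_reverse h0 (IsUntruncated.of_reverse h1 ?_),
      fun ht => IsUntruncated.of_reverse h1 (IsUntruncated.of_reverse h0 ?_)⟩
    · rwa [show (2 : ℝ) - (0 - t) = t + 2 by ring]
    · rwa [show (0 : ℝ) - (2 - (t + 2)) = t by ring]
  obtain ⟨u, hu, e⟩ := hper.exists_mem_Ico₀ (by norm_num) t
  rw [e]
  rcases le_total u 1 with hu1 | hu1
  · exact h u ⟨hu.1, hu1⟩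
  · exact IsUntruncated.of_reverse h1 (h _ ⟨by linarith [hu.2], by linarith⟩)

/-! ### Signs along the orbit -/

namespace FigureEightData
open IntPoly

lemma near_re {z w : ℂ} {R : ℝ} (h : ‖z - w‖ ≤ R) : |z.re - w.re| ≤ R :=
  (Complex.abs_re_le_norm (z - w)).trans h

lemma near_im {z w : ℂ} {R : ℝ} (h : ‖z - w‖ ≤ R) : |z.im - w.im| ≤ R :=
  (Complex.abs_im_le_norm (z - w)).trans h

lemma near_vel {s p : BodyState} {R : ℝ} (h : ‖s - p‖ ≤ R) (i : Fin 3) : ‖s.2 i - p.2 i‖ ≤ R :=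
  (norm_vel_le (s - p) i).trans h

lemma near_pos {s p : BodyState} {R : ℝ} (h : ‖s - p‖ ≤ R) (i : Fin 3) : ‖s.1 i - p.1 i‖ ≤ R :=
  (norm_pos_le (s - p) i).trans h

section Signs
variable {s : BodyState} {t : ℝ} (ht : t ∈ Icc (0 : ℝ) 1) (h : ‖s - approxState t‖ ≤ 3 / 10 ^ 5)
include ht h

lemma velX_re_pos_of_near : 0 < (s.2 2).re := by
  have h1 := velX_re_neg.le (Icc_zero_subset ht)
  have h2 := (abs_le.1 (near_re (near_vel h 2))).1
  have e : ((approxState t).2 2).re = 3⁻¹ * (eval (smul (-1) (pairD (der yRe))) t / 10 ^ 16) := by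
    simp [approxState, symState, approxVel]; ring
  push_cast at h1
  rw [e] at h2
  linarith

lemma velX_im_pos_of_near : 0 < (s.2 2).im := by
  have h1 := velX_im_neg.le (Icc_zero_subset ht)
  have h2 := (abs_le.1 (near_im (near_vel h 2))).1
  have e : ((approxState t).2 2).im = 3⁻¹ * (eval (smul (-1) (pairD (der yIm))) t / 10 ^ 16) := by
    simp [approxState, symState, approxVel]; ring
  push_cast at h1
  rw [e] at h2
  linarith

lemma velY_re_neg_of_near : (s.2 1).re < 0 := by
  have h1 := velY_re_neg.le (Icc_zero_subset ht)
  have h2 := (abs_le.1 (near_re (near_vel h 1))).2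
  have e : ((approxState t).2 1).re = 3⁻¹ * (eval (der yRe) t / 10 ^ 16) := by
    simp [approxState, symState, approxVel]
  simp only [eval_sub, eval_smul, eval_cons, eval_nil] at h1
  push_cast at h1
  rw [e] at h2
  linarith [ht.1]

lemma posY_im_neg_of_near : (s.1 1).im < 0 := by
  have h1 := posY_im_neg.le (Icc_zero_subset ht)
  have h2 := (abs_le.1 (near_im (near_pos h 1))).2
  have e : ((approxState t).1 1).im = eval yIm t / 10 ^ 16 := by
    simp [approxState, symState, approxY]
  simp only [eval_sub, eval_smul, eval_cons, eval_nil] at h1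
  push_cast at h1
  rw [e] at h2
  linarith [ht.1]

lemma velZ_im_neg_of_near : (s.2 0).im < 0 := by
  have h1 := velY_im_neg.le (neg_mem_Icc (Icc_zero_subset ht))
  have h2 := (abs_le.1 (near_im (near_vel h 0))).2
  have e : ((approxState t).2 0).im = 3⁻¹ * (eval (der yIm) (-t) / 10 ^ 16) := by
    simp [approxState, symState, approxVel]
  simp only [eval_add, eval_smul, eval_cons, eval_nil] at h1
  push_cast at h1
  rw [e] at h2
  linarith [ht.1]

/-- The Lipschitz bound carries closeness of states over to accelerations: `3 * (3 / 10 ^ 5)` plus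
the residual is far below the margin `1 / 300`. -/
lemma accZ_re_pos_of_near : 0 < ((truncField s).2 0).re := by
  have h1 := accY_re_neg.le (neg_mem_Icc (Icc_zero_subset ht))
  have h2 : ‖truncField s - approxStateDeriv t‖ ≤ 1 / 10 ^ 4 := by
    have k1 := truncField_lipschitz.dist_le_mul s (approxState t)
    have k2 := approxState_residual ht
    rw [dist_eq_norm, dist_eq_norm, NNReal.coe_ofNat] at k1
    rw [norm_sub_rev] at k2
    have k3 := norm_sub_le_norm_sub_add_norm_sub (truncField s) (truncField (approxState t))
      (approxStateDeriv t)
    linarith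
  have h3 := (abs_le.1 (near_re (near_vel h2 0))).1
  have e : ((approxStateDeriv t).2 0).re =
      3⁻¹ * (eval (smul (-1) (der (der yRe))) (-t) / 10 ^ 16) := by
    simp [approxStateDeriv, symStateDeriv, approxAcc]
    ring
  push_cast at h1
  rw [e] at h3
  linarith

end Signs

lemma initial_stateMomentum {x : ℝ → BodyState} {c : Fin 4 → ℝ}
    (h0 : x 0 = approxState 0 + linState c 0) : stateMomentum (x 0) = 0 := by
  rw [h0]
  simp [stateMomentum, approxState, linState, symState, Fin.sum_univ_three]
  ring

theorem exists_isEightSolution : ∃ x, IsEightSolution x := by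
  obtain ⟨x, c, hx, h0, h1, h⟩ := exists_truncSolution_isosceles
  have r0 := reverse_zero_eq hx h0
  have r1 := reverse_one_eq hx h0 h h1
  exact ⟨x,
    { solution := hx
      untruncated := isUntruncated_of_symmetric r0 r1
        fun t ht => isUntruncated_of_near ht (h t ht)
      momentum := fun t => by rw [hx.stateMomentum_eq, initial_stateMomentum h0]
      reverse_zero := r0
      reverse_one := r1
      velX_re_pos := fun t ht => velX_re_pos_of_near ht (h t ht)
      velX_im_pos := fun t ht => velX_im_pos_of_near ht (h t ht)
      velY_re_neg := fun t ht => velY_re_neg_of_near ht (h t ht)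
      posY_im_neg := fun t ht => posY_im_neg_of_near ht (h t ht)
      velZ_im_neg := fun t ht => velZ_im_neg_of_near ht (h t ht)
      accZ_re_pos := fun t ht => accZ_re_pos_of_near ht (h t ht) }⟩

end FigureEightData

/-! ### From the symmetries to the choreography and the curve -/

namespace IsEightSolution
variable {x : ℝ → BodyState} (h : IsEightSolution x)
include h

lemma pos_neg (i : Fin 3) (t : ℝ) : (x (-t)).1 i = -(x t).1 (Equiv.swap 0 1 i) := by
  have := congrFun h.reverse_zero (-t)
  rw [← this]
  simp [reverseWith]

lemma vel_neg (i : Fin 3) (t : ℝ) : (x (-t)).2 i = (x t).2 (Equiv.swap 0 1 i) := by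
  have := congrFun h.reverse_zero (-t)
  rw [← this]
  simp [reverseWith]

lemma pos_two_sub (i : Fin 3) (t : ℝ) :
    (x (2 - t)).1 i = (starRingEnd ℂ) ((x t).1 (Equiv.swap 1 2 i)) := by
  have := congrFun h.reverse_one (2 - t)
  rw [← this]
  simp [reverseWith]

lemma vel_two_sub (i : Fin 3) (t : ℝ) :
    (x (2 - t)).2 i = -(starRingEnd ℂ) ((x t).2 (Equiv.swap 1 2 i)) := by
  have := congrFun h.reverse_one (2 - t)
  rw [← this]
  simp [reverseWith]

lemma pos_add_two (i : Fin 3) (t : ℝ) :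
    (x (t + 2)).1 i = -(starRingEnd ℂ) ((x t).1 (Equiv.swap 0 1 (Equiv.swap 1 2 i))) := by
  rw [show t + 2 = 2 - -t by ring, h.pos_two_sub, h.pos_neg, map_neg]

lemma vel_add_two (i : Fin 3) (t : ℝ) :
    (x (t + 2)).2 i = -(starRingEnd ℂ) ((x t).2 (Equiv.swap 0 1 (Equiv.swap 1 2 i))) := by
  rw [show t + 2 = 2 - -t by ring, h.vel_two_sub, h.vel_neg]

/-- The shift by 2 reflects the plane and permutes the bodies. Its square involves no reflection,
and the permutation left over is a 3-cycle: the time lag of the choreography. -/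
lemma pos_add_four (i : Fin 3) (t : ℝ) : (x (t + 4)).1 i =
    (x t).1 (Equiv.swap 0 1 (Equiv.swap 1 2 (Equiv.swap 0 1 (Equiv.swap 1 2 i)))) := by
  rw [show t + 4 = t + 2 + 2 by ring, h.pos_add_two, h.pos_add_two, map_neg, neg_neg,
    Complex.conj_conj]

lemma pos_two_add_four (t : ℝ) : (x (t + 4)).1 2 = (x t).1 1 := by
  rw [h.pos_add_four]
  congr 1

lemma pos_one_add_four (t : ℝ) : (x (t + 4)).1 1 = (x t).1 0 := by
  rw [h.pos_add_four]
  congr 1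

lemma pos_zero_add_four (t : ℝ) : (x (t + 4)).1 0 = (x t).1 2 := by
  rw [h.pos_add_four]
  congr 1

lemma hasDerivAt_pos (i : Fin 3) (t : ℝ) :
    HasDerivAt (fun t => (x t).1 i) ((3 : ℝ) • (x t).2 i) t := by
  have := h.solution.hasDerivAt_fst i t
  rwa [truncVel_of_le ((h.untruncated t).1 i)] at this

lemma velZ_one_re : ((x 1).2 0).re = 0 := by
  have := congrArg Complex.re (h.vel_two_sub 0 1)
  rw [show (2 : ℝ) - 1 = 1 by norm_num, show Equiv.swap (1 : Fin 3) 2 0 = 0 by decide,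
    Complex.neg_re, Complex.conj_re] at this
  linarith

lemma posZ_one_im : ((x 1).1 0).im = 0 := by
  have := congrArg Complex.im (h.pos_two_sub 0 1)
  rw [show (2 : ℝ) - 1 = 1 by norm_num, show Equiv.swap (1 : Fin 3) 2 0 = 0 by decide,
    Complex.conj_im] at this
  linarith

lemma posX_zero : (x 0).1 2 = 0 := by
  have := h.pos_neg 2 0
  rw [neg_zero, show Equiv.swap (0 : Fin 3) 1 2 = 2 by decide] at this
  exact self_eq_neg.1 this

/-- This velocity vanishes at time 1, so closeness to the approximate orbit cannot decide its sign;
it is negative before because it increases to zero. `posZ_im_pos` and `posX_im_pos` use the same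
device. -/
lemma velZ_re_neg {t : ℝ} (ht : t ∈ Ico (0 : ℝ) 1) : ((x t).2 0).re < 0 := by
  have hd (t : ℝ) : HasDerivAt (fun t => ((x t).2 0).re) ((truncField (x t)).2 0).re t := by
    have := (Complex.reCLM.hasFDerivAt (x := (x t).2 0)).comp_hasDerivAt t
      (h.solution.hasDerivAt_snd 0 t)
    exact this
  have hm : StrictMonoOn (fun t => ((x t).2 0).re) (Icc 0 1) := by
    refine strictMonoOn_of_deriv_pos (convex_Icc 0 1)
      (fun t _ => (hd t).continuousAt.continuousWithinAt) fun t ht => ?_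
    rw [interior_Icc] at ht
    rw [(hd t).deriv]
    exact h.accZ_re_pos t (Ioo_subset_Icc_self ht)
  have := hm (Ico_subset_Icc_self ht) (by simp) ht.2
  simpa [h.velZ_one_re] using this

lemma hasDerivAt_im (i : Fin 3) (t : ℝ) :
    HasDerivAt (fun t => ((x t).1 i).im) (3 * ((x t).2 i).im) t := by
  have := (Complex.imCLM.hasFDerivAt (x := (x t).1 i)).comp_hasDerivAt t (h.hasDerivAt_pos i t)
  exact this.congr_deriv (by simp)

lemma posZ_im_pos {t : ℝ} (ht : t ∈ Ico (0 : ℝ) 1) : 0 < ((x t).1 0).im := by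
  have hm : StrictAntiOn (fun t => ((x t).1 0).im) (Icc 0 1) := by
    refine strictAntiOn_of_deriv_neg (convex_Icc 0 1)
      (fun t _ => (h.hasDerivAt_im 0 t).continuousAt.continuousWithinAt) fun t ht => ?_
    rw [interior_Icc] at ht
    rw [(h.hasDerivAt_im 0 t).deriv]
    linarith [h.velZ_im_neg t (Ioo_subset_Icc_self ht)]
  have := hm (Ico_subset_Icc_self ht) (by simp) ht.2
  simpa [h.posZ_one_im] using this

lemma posX_im_pos {t : ℝ} (ht : t ∈ Ioc (0 : ℝ) 1) : 0 < ((x t).1 2).im := by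
  have hm : StrictMonoOn (fun t => ((x t).1 2).im) (Icc 0 1) := by
    refine strictMonoOn_of_deriv_pos (convex_Icc 0 1)
      (fun t _ => (h.hasDerivAt_im 2 t).continuousAt.continuousWithinAt) fun t ht => ?_
    rw [interior_Icc] at ht
    rw [(h.hasDerivAt_im 2 t).deriv]
    linarith [h.velX_im_pos t (Ioo_subset_Icc_self ht)]
  have := hm (by simp) (Ioc_subset_Icc_self ht) ht.1
  simpa [h.posX_zero] using this

/-- The first quarter of the path of X is its own arc over `[0, 1]`, followed by reflected copies of
the arcs of Y (run backwards) and of Z. -/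
lemma velX_re_pos_of_mem {t : ℝ} (ht : t ∈ Ico (0 : ℝ) 3) : 0 < ((x t).2 2).re := by
  rcases le_total t 1 with h1 | h1
  · exact h.velX_re_pos t ⟨ht.1, h1⟩
  rcases le_or_gt t 2 with h2 | h2
  · have := h.vel_two_sub 2 (2 - t)
    rw [sub_sub_cancel, show Equiv.swap (1 : Fin 3) 2 2 = 1 by decide] at this
    rw [this, Complex.neg_re, Complex.conj_re]
    linarith [h.velY_re_neg (2 - t) ⟨by linarith, by linarith⟩]
  · have := h.vel_add_two 2 (t - 2)
    rw [sub_add_cancel, show Equiv.swap (0 : Fin 3) 1 (Equiv.swap 1 2 2) = 0 by decide] at this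
    rw [this, Complex.neg_re, Complex.conj_re]
    linarith [h.velZ_re_neg (t := t - 2) ⟨by linarith, by linarith [ht.2]⟩]

lemma posX_im_pos_of_mem {t : ℝ} (ht : t ∈ Ioo (0 : ℝ) 3) : 0 < ((x t).1 2).im := by
  rcases le_total t 1 with h1 | h1
  · exact h.posX_im_pos ⟨ht.1, h1⟩
  rcases le_or_gt t 2 with h2 | h2
  · have := h.pos_two_sub 2 (2 - t)
    rw [sub_sub_cancel, show Equiv.swap (1 : Fin 3) 2 2 = 1 by decide] at this
    rw [this, Complex.conj_im]
    linarith [h.posY_im_neg (2 - t) ⟨by linarith, by linarith⟩]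
  · have := h.pos_add_two 2 (t - 2)
    rw [sub_add_cancel, show Equiv.swap (0 : Fin 3) 1 (Equiv.swap 1 2 2) = 0 by decide] at this
    rw [this, Complex.neg_im, Complex.conj_im, neg_neg]
    exact h.posZ_im_pos ⟨by linarith, by linarith [ht.2]⟩

lemma pos_reflect (t : ℝ) : (x (6 - t)).1 2 = (starRingEnd ℂ) ((x t).1 2) := by
  have h1 := h.pos_two_add_four (2 - t)
  rw [show 2 - t + 4 = 6 - t by ring] at h1
  rw [h1, h.pos_two_sub]
  congr 2

theorem isSymmetricEight {l : ℝ} (hl : 0 < l) :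
    IsSymmetricEight (fun t => l • (x t).1 2) (fun t => l • (3 : ℝ) • (x t).2 2) where
  hasDerivAt t := (h.hasDerivAt_pos 2 t).const_smul l
  continuous_vel := by
    have : Continuous fun t => (x t).2 2 :=
      continuous_iff_continuousAt.2 fun t => (h.solution.hasDerivAt_snd 2 t).continuousAt
    exact (this.const_smul (3 : ℝ)).const_smul l
  odd t := by
    rw [h.pos_neg, show Equiv.swap (0 : Fin 3) 1 2 = 2 by decide, smul_neg]
  reflect t := by
    rw [h.pos_reflect]
    simp
  vel_re_pos t ht := by
    have := h.velX_re_pos_of_mem ht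
    simp only [Complex.smul_re, smul_eq_mul]
    positivity
  im_pos t ht := by
    have := h.posX_im_pos_of_mem ht
    simp only [Complex.smul_im, smul_eq_mul]
    positivity
  vel_three := by
    have h1 := h.vel_add_two 2 1
    rw [show (1 : ℝ) + 2 = 3 by norm_num,
      show Equiv.swap (0 : Fin 3) 1 (Equiv.swap 1 2 2) = 0 by decide] at h1
    rw [h1]
    have h2 := (h.velZ_im_neg 1 (by simp)).ne
    intro h3
    have h4 := congrArg Complex.im h3
    simp [hl.ne'] at h4
    exact h2 h4
  vel_zero_im := by
    have := (h.velX_im_pos 0 (by simp))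
    simp only [Complex.smul_im, smul_eq_mul]
    positivity

theorem isChoreography (l : ℝ) :
    IsChoreography 12 (fun t => l • (x t).1 2) (fun i t => l • (x t).1 i) where
  period_pos := by norm_num
  periodic t := by
    simp only
    rw [show t + 12 = t + 4 + 4 + 4 by ring, h.pos_two_add_four, h.pos_one_add_four,
      h.pos_zero_add_four]
  chase i t := by
    fin_cases i
    · have := h.pos_zero_add_four (t - 4)
      rw [sub_add_cancel] at this
      simp only [Fin.zero_eta, this]
      norm_num
    · have h1 := h.pos_one_add_four (t - 4)
      have h2 := h.pos_zero_add_four (t - 8)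
      rw [sub_add_cancel] at h1
      rw [show t - 8 + 4 = t - 4 by ring] at h2
      simp only [Fin.mk_one, h1, h2]
      norm_num
    · have h1 := h.pos_two_add_four (t - 4)
      have h2 := h.pos_one_add_four (t - 8)
      have h3 := h.pos_zero_add_four (t - 12)
      rw [sub_add_cancel] at h1
      rw [show t - 8 + 4 = t - 4 by ring] at h2
      rw [show t - 12 + 4 = t - 8 by ring] at h3
      simp only [Fin.reduceFinMk, h1, h2, h3]
      norm_num

lemma hasDerivAt_scaled (l : ℝ) (i : Fin 3) (t : ℝ) :
    HasDerivAt (fun t => l • (x t).1 i) (l • (3 : ℝ) • (x t).2 i) t :=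
  (h.hasDerivAt_pos i t).const_smul l

lemma deriv_scaled (l : ℝ) (i : Fin 3) :
    deriv (fun t => l • (x t).1 i) = fun t => l • (3 : ℝ) • (x t).2 i :=
  funext fun t => (h.hasDerivAt_scaled l i t).deriv

lemma hasDerivAt_scaled_vel (l : ℝ) (i : Fin 3) (t : ℝ) :
    HasDerivAt (fun t => l • (3 : ℝ) • (x t).2 i) (l • truncAcc (x t).1 i) t := by
  refine (((h.solution.hasDerivAt_snd i t).const_smul (3 : ℝ)).const_smul l).congr_deriv ?_
  rw [smul_inv_smul₀ (by norm_num)]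

/-- Masses `l ^ 3` at distances scaled by `l` produce accelerations scaled by `l ^ 3 / l ^ 2 = l`,
so time needs no rescaling and the period remains 12. -/
lemma gravForce_scaled {l : ℝ} (hl : 0 < l) (t : ℝ) {i j : Fin 3} (hij : j ≠ i) :
    gravForce (fun _ => l ^ 3) (fun k => l • (x t).1 k) j i =
      l ^ 3 • l • truncForce ((x t).1 j - (x t).1 i) := by
  have hd := (h.untruncated t).2 j i hij
  have hpos : 0 < ‖(x t).1 j - (x t).1 i‖ := by linarith
  rw [truncForce_of_le hd, gravForce, ← smul_sub, norm_smul, Real.norm_of_nonneg hl.le, smul_smul,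
    smul_smul, smul_smul]
  congr 1
  field_simp

theorem isThreeBodySolution {l : ℝ} (hl : 0 < l) :
    IsThreeBodySolution (fun _ => l ^ 3) (fun i t => l • (x t).1 i) where
  collision_free t i j hij e := by
    have hd := (h.untruncated t).2 i j hij
    rw [smul_right_injective ℂ hl.ne' e, sub_self, norm_zero] at hd
    norm_num at hd
  differentiable i t := (h.hasDerivAt_scaled l i t).differentiableAt
  differentiable_velocity i := by
    rw [h.deriv_scaled]
    exact fun t => (h.hasDerivAt_scaled_vel l i t).differentiableAt
  newton i t := by
    rw [h.deriv_scaled, (h.hasDerivAt_scaled_vel l i t).deriv, truncAcc, Finset.smul_sum,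
      Finset.smul_sum, ← Finset.sum_erase Finset.univ (a := i) (by simp [truncForce_zero])]
    exact Finset.sum_congr rfl fun j hj => (h.gravForce_scaled hl t (Finset.ne_of_mem_erase hj)).symm

theorem angularMomentum_eq_zero (m l : ℝ) (t : ℝ) :
    angularMomentum (fun _ => m) (fun i => l • (x t).1 i)
      (fun i => deriv (fun t => l • (x t).1 i) t) = 0 := by
  have e : angularMomentum (fun _ => m) (fun i => l • (x t).1 i)
      (fun i => deriv (fun t => l • (x t).1 i) t) = m * l ^ 2 * 3 * stateMomentum (x t) := by
    simp only [h.deriv_scaled, angularMomentum, stateMomentum, Finset.mul_sum]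
    refine Finset.sum_congr rfl fun i _ => ?_
    simp
    ring
  rw [e, h.momentum, mul_zero]

end IsEightSolution

theorem mainTheorem7 (m : ℝ) (hm : 0 < m) :
    ∃ (T : ℝ) (s : ℝ → ℂ) (q : Fin 3 → ℝ → ℂ),
      IsThreeBodySolution (fun _ => m) q ∧
      (∀ t, angularMomentum (fun _ => m) (fun i => q i t) (fun i => deriv (q i) t) = 0) ∧
      IsChoreography T s q ∧
      IsFigureEight T s := by
  obtain ⟨x, h⟩ := FigureEightData.exists_isEightSolution
  have hl : 0 < m ^ (3⁻¹ : ℝ) := Real.rpow_pos_of_pos hm _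
  have hlm : (m ^ (3⁻¹ : ℝ)) ^ 3 = m := Real.rpow_inv_natCast_pow hm.le (n := 3) (by norm_num)
  refine ⟨12, fun t => m ^ (3⁻¹ : ℝ) • (x t).1 2, fun i t => m ^ (3⁻¹ : ℝ) • (x t).1 i, ?_,
    fun t => h.angularMomentum_eq_zero m _ t, h.isChoreography _, (h.isSymmetricEight hl).isFigureEight⟩
  have := h.isThreeBodySolution hl
  rwa [hlm] at this
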